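/- For $t\in\mathbb R$ let $U(t)$ be the unitary operator on $L^2(\mathbb R^3)$ with Fourier multiplier $e^{-it(\xi_1^2+\xi_2^2+\xi_3)}$, where the Fourier transform is taken with kernel $e^{-i x\cdot\xi}$; that is, $u(t)=U(t)f$ solves $\partial_t u+\partial_z u-i(\partial_x^2+\partial_y^2)u=0$, $u(0)=f$. Write $$\|g\|_{L^q_tL^p_{xy}L^2_z}=\Big\|\,\big\|\,\|g(x,y,z,t)\|_{L^2_z(\mathbb R)}\big\|_{L^p_{xy}(\mathbb R^2)}\Big\|_{L^q_t(\mathbb R)} .$$ **Strichartz estimates.** Let $2\le p<\infty$ and let $q\in(2,\infty]$ be given by $\frac2q=1-\frac2p$. Let $p',q'$ be the conjugate exponents, $\frac1p+\frac1{p'}=\frac1q+\frac1{q'}=1$. There is a constant $c$ (depending only on $p$) such that, for all $f\in L^2(\mathbb R^3)$ and all $g\in L^{q'}_tL^{p'}_{xy}L^2_z$, $$\|U(t)f\|_{L^q_tL^p_{xy}L^2_z}\le c\,\|f\|_{L^2_{xyz}},$$ $$\Big\|\int_{\mathbb R}U(t-t')g(\cdot,t')\,dt'\Big\|_{L^q_tL^p_{xy}L^2_z}\le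 c\,\|g\|_{L^{q'}_tL^{p'}_{xy}L^2_z},$$ $$\Big\|\int_{\mathbb R}U(t)g(\cdot,t)\,dt\Big\|_{L^2_{xyz}}\le c\,\|g\|_{L^{q'}_tL^{p'}_{xy}L^2_z}.$$ The integrals over $\mathbb R$ are taken in the sense of tempered distributions: $h=\int_{\mathbb R}U(\sigma(s))g(\cdot,s)\,ds$ means $\langle\varphi,h\rangle=\int_{\mathbb R}\langle U(-\sigma(s))\varphi,\,g(\cdot,s)\rangle\,ds$ with absolute convergence for every Schwartz function $\varphi$ on $\mathbb R^3$, where $\langle a,b\rangle=\int_{\mathbb R^3}\overline{a}\,b$. Part of the claim is that they exist and define elements of $L^2(\mathbb R^3)$, for every $t$ in the case of the second one. -/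

import Mathlib

open MeasureTheory
open scoped ENNReal NNReal FourierTransform SchwartzMap

noncomputable section

namespace ZakharovStrichartz

/-- Physical space `ℝ³`, with coordinates `(x, y, z) = (v 0, v 1, v 2)`. -/
abbrev R3 := EuclideanSpace ℝ (Fin 3)

/-- The Hilbert space `L²(ℝ³; ℂ)`. -/
abbrev L2 := Lp (α := R3) ℂ 2 volume

/-- The phase `-t (k₁² + k₂² + k₃)` with `k = 2πξ`. Mathlib's Fourier transform has the kernel
`exp (-2πi x·ξ)`, so that the angular frequency, in which the symbol of the equation
`∂ₜ E + ∂_z E - i (∂ₓ² + ∂_y²) E = 0` is `-i (k₁² + k₂² + k₃)`, is `k = 2πξ`. -/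
def phase (t : ℝ) (ξ : R3) : ℝ :=
  -t * ((2 * Real.pi * ξ 0) ^ 2 + (2 * Real.pi * ξ 1) ^ 2 + 2 * Real.pi * ξ 2)

/-- The multiplier `exp (-i t (k₁² + k₂² + k₃))`, `k = 2πξ`, of the linear group. -/
def symbol (t : ℝ) (ξ : R3) : ℂ := Complex.exp (phase t ξ * Complex.I)

lemma norm_symbol (t : ℝ) (ξ : R3) : ‖symbol t ξ‖ = 1 :=
  Complex.norm_exp_ofReal_mul_I _

lemma continuous_symbol (t : ℝ) : Continuous (symbol t) := by
  unfold symbol phase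
  fun_prop

lemma memLp_symbol_mul (t : ℝ) (f : L2) :
    MemLp (fun ξ => symbol t ξ * f ξ) 2 (volume : Measure R3) :=
  MemLp.of_le (Lp.memLp f)
    ((continuous_symbol t).aestronglyMeasurable.mul (Lp.aestronglyMeasurable f))
    (Filter.Eventually.of_forall fun ξ => by rw [norm_mul, norm_symbol, one_mul])

/-- The unitary group on `L²(ℝ³)`: `U t f` is the inverse Fourier transform of
`symbol t * (Fourier transform of f)`. -/
def U (t : ℝ) (f : L2) : L2 :=
  𝓕⁻ ((memLp_symbol_mul t (𝓕 f)).toLp (fun ξ => symbol t ξ * (𝓕 f : L2) ξ))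

/-- The same group on Schwartz functions. -/
def US (t : ℝ) (φ : 𝓢(R3, ℂ)) : 𝓢(R3, ℂ) :=
  SchwartzMap.fourierMultiplierCLM ℂ (symbol t) φ

lemma hasTemperateGrowth_expI :
    (fun s : ℝ => Complex.exp (s * Complex.I)).HasTemperateGrowth := by
  refine ⟨(Complex.ofRealCLM.contDiff.mul contDiff_const).cexp, fun n => ⟨0, 1, fun x => ?_⟩⟩
  rw [norm_iteratedFDeriv_eq_norm_iteratedDeriv]
  have h : ∀ n : ℕ, iteratedDeriv n (fun s : ℝ => Complex.exp (s * Complex.I)) =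
      fun s : ℝ => Complex.I ^ n * Complex.exp (s * Complex.I) := by
    intro n
    induction n with
    | zero => simp
    | succ k ih =>
      rw [iteratedDeriv_succ, ih]
      funext s
      have h1 : HasDerivAt (fun s : ℝ => (s : ℂ) * Complex.I) Complex.I s := by
        simpa using (Complex.ofRealCLM.hasDerivAt (x := s)).mul_const Complex.I
      rw [(h1.cexp.const_mul (Complex.I ^ k)).deriv]
      ring
  rw [h]
  simp [Complex.norm_exp_ofReal_mul_I]

lemma hasTemperateGrowth_symbol (t : ℝ) : (symbol t).HasTemperateGrowth := by
  have hc (i : Fin 3) : (fun ξ : R3 => ξ i).HasTemperateGrowth :=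
    (EuclideanSpace.proj (𝕜 := ℝ) i : R3 →L[ℝ] ℝ).hasTemperateGrowth
  have h0 := hc 0
  have h1 := hc 1
  have h2 := hc 2
  have hp : (phase t).HasTemperateGrowth := by
    unfold phase
    simp only [pow_two]
    fun_prop
  exact hasTemperateGrowth_expI.comp hp

/-- Explicit form of the group on Schwartz functions. -/
lemma US_eq (t : ℝ) (φ : 𝓢(R3, ℂ)) (x : R3) :
    US t φ x = 𝓕⁻ (fun ξ : R3 => symbol t ξ * 𝓕 (φ : R3 → ℂ) ξ) x := by
  rw [US, SchwartzMap.fourierMultiplierCLM_apply, SchwartzMap.fourierInv_coe,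
    SchwartzMap.smulLeftCLM_apply (hasTemperateGrowth_symbol t), SchwartzMap.fourier_coe]
  rfl

/-- The two versions of the group agree on Schwartz functions. -/
lemma U_toLp (t : ℝ) (φ : 𝓢(R3, ℂ)) : U t (φ.toLp 2) = (US t φ).toLp 2 := by
  rw [US, SchwartzMap.fourierMultiplierCLM_apply, ← SchwartzMap.toLp_fourierInv_eq, U]
  congr 1
  apply Lp.ext
  refine (MemLp.coeFn_toLp _).trans ?_
  refine Filter.EventuallyEq.trans ?_ (SchwartzMap.coeFn_toLp _ 2 volume).symm
  rw [SchwartzMap.toLp_fourier_eq]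
  filter_upwards [SchwartzMap.coeFn_toLp (𝓕 φ) 2 (volume : Measure R3)] with ξ hξ
  rw [hξ, SchwartzMap.smulLeftCLM_apply_apply (hasTemperateGrowth_symbol t), smul_eq_mul]

/-- The norm of `L^p_{xy} L²_z(ℝ³)`. -/
def spaceNorm (p : ℝ≥0∞) (f : R3 → ℂ) : ℝ≥0∞ :=
  eLpNorm (fun w : ℝ × ℝ => eLpNorm (fun z : ℝ => f !₂[w.1, w.2, z]) 2 volume) p volume

/-- The norm of `L^q_t L^p_{xy} L²_z(ℝ × ℝ³)`. -/
def mixedNorm (q p : ℝ≥0∞) (g : ℝ → R3 → ℂ) : ℝ≥0∞ :=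
  eLpNorm (fun t : ℝ => spaceNorm p (g t)) q volume

/-- `g` belongs to `L^q_t L^p_{xy} L²_z(ℝ × ℝ³)`. -/
def MemMixed (q p : ℝ≥0∞) (g : ℝ → R3 → ℂ) : Prop :=
  AEStronglyMeasurable (fun v : ℝ × R3 => g v.1 v.2) (volume : Measure (ℝ × R3)) ∧
    mixedNorm q p g < ∞

/-- `h = ∫_ℝ U(σ(s)) g(·, s) ds`. For `g` in `L^{q'}_t L^{p'}_{xy} L²_z` the slices `g(·, s)`
need not lie in `L²(ℝ³)`; the integrand is a tempered distribution for a.e. `s`, with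
`⟨φ, U(σ(s)) g(·, s)⟩ = ⟨U(-σ(s)) φ, g(·, s)⟩`, and the integral is taken in the sense of
tempered distributions: its pairing with each Schwartz function `φ` is the (absolutely
convergent) integral of the pairings. -/
def IsGroupIntegral (σ : ℝ → ℝ) (g : ℝ → R3 → ℂ) (h : L2) : Prop :=
  ∀ φ : 𝓢(R3, ℂ),
    Integrable (fun v : ℝ × R3 => starRingEnd ℂ (US (-σ v.1) φ v.2) * g v.1 v.2) ∧
    ∫ x : R3, starRingEnd ℂ (φ x) * h x =
      ∫ s : ℝ, ∫ x : R3, starRingEnd ℂ (US (-σ s) φ x) * g s x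

/-- The integral is unique. -/
lemma IsGroupIntegral.unique {σ : ℝ → ℝ} {g : ℝ → R3 → ℂ} {h h' : L2}
    (H : IsGroupIntegral σ g h) (H' : IsGroupIntegral σ g h') : h = h' := by
  have key (k : L2) (φ : 𝓢(R3, ℂ)) :
      inner ℂ (φ.toLp 2) k = ∫ x : R3, starRingEnd ℂ (φ x) * k x := by
    rw [L2.inner_def]
    apply integral_congr_ae
    filter_upwards [SchwartzMap.coeFn_toLp φ 2 (volume : Measure R3)] with x hx
    rw [hx, RCLike.inner_apply, mul_comm]
  refine (SchwartzMap.denseRange_toLpCLM (E := R3) (F := ℂ) (p := 2)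
    (μ := volume) ENNReal.ofNat_ne_top).eq_of_inner_right ℂ ?_
  intro φ
  exact ((key h φ).trans (((H φ).2.trans (H' φ).2.symm))).trans (key h' φ).symm

end ZakharovStrichartz

end

open ZakharovStrichartz

/-! The flow is the free Schrödinger flow in (x, y) combined with the translation of z by t. The
translation preserves the L²_z norm and the two-dimensional Schrödinger kernel is O(1/|t|), so that
|⟨f, U(t)g⟩| ≤ |t|⁻¹ ‖f‖ ‖g‖ in L¹_{xy}L²_z (`enorm_inner_U_le`). As the kernel is a point mass in
z, this is proved for a symbol damped by a Gaussian, with bounds uniform in the damping.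

Put α = 1 - 2/p = 2/q, so that 0 ≤ α < 1, p = 2/(1-α), p' = 2/(1+α), q' = 2/(2-α). Interpolation
with unitarity, by the three lines theorem, gives the decay |t|^{-α} in L^{p'}_{xy}L²_z
(`enorm_inner_U_le_rpow`). In the TT* identity ‖∫ U(-t)G(t) dt‖² = ∬ ⟨G(s), U(s-t)G(t)⟩ ds dt this
leaves the kernel |s-t|^{-α}, which the diagonal Hardy–Littlewood–Sobolev inequality bounds on
L^{q'} (`lintegral_lintegral_rieszKernel_le`, `enorm_integral_U_le`).

Aligning the phase of g with that of U(t)φ turns this into a bound of ∬ |U(t)φ| |g| for Schwartz φ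
and every measurable g (`lintegral_US_mul_le`), from which everything follows. The Riesz
representation theorem yields the integral of the third estimate and its norm
(`exists_isGroupIntegral`). An explicit extremiser of the duality pairing yields the first estimate
for Schwartz data, and density with Fatou's lemma extends it to L² (`mixedNorm_U_le`); for p = 2 it
is unitarity. The integral of the second estimate has no causal cut-off, hence equals U(t) applied
to ∫ U(-t')g(t') dt', and the other two estimates compose. -/

noncomputable section

namespace ZakharovStrichartz

/-! ### The Hardy–Littlewood–Sobolev inequality on the line -/

/-- The Riesz kernel `|u|^{-α}` as an extended nonnegative number. -/
def rieszKernel (α : ℝ) (u : ℝ) : ℝ≥0∞ := ENNReal.ofReal |u| ^ (-α)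

lemma measurable_rieszKernel (α : ℝ) : Measurable (rieszKernel α) := by
  unfold rieszKernel
  fun_prop

lemma rieszKernel_neg (α u : ℝ) : rieszKernel α (-u) = rieszKernel α u := by
  simp [rieszKernel]

lemma lintegral_comp_abs (f : ℝ → ℝ≥0∞) (hf : Measurable f) :
    ∫⁻ u, f |u| = 2 * ∫⁻ u in Set.Ioi 0, f u := by
  have h1 : ∫⁻ u in Set.Ioi (0:ℝ), f |u| = ∫⁻ u in Set.Ioi (0:ℝ), f u :=
    setLIntegral_congr_fun measurableSet_Ioi fun u hu => by rw [abs_of_pos hu]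
  have h2 : ∫⁻ u in Set.Iio (0:ℝ), f |u| = ∫⁻ u in Set.Ioi (0:ℝ), f u := by
    rw [← h1]
    have := (Measure.measurePreserving_neg (volume : Measure ℝ)).setLIntegral_comp_preimage
      (s := Set.Iio 0) measurableSet_Iio (f := fun u => f |u|) (by fun_prop)
    rw [← this]
    simp
  have h3 : ∫⁻ u in Set.Iic (0:ℝ), f |u| = ∫⁻ u in Set.Iio (0:ℝ), f |u| :=
    setLIntegral_congr Iio_ae_eq_Iic.symm
  rw [← lintegral_add_compl (fun u => f |u|) measurableSet_Ioi (A := Set.Ioi (0:ℝ)), Set.compl_Ioi,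
    h3, h1, h2, two_mul]

lemma lintegral_rieszKernel_near {α : ℝ} (h1 : α < 1) {R : ℝ} (hR : 0 < R) :
    ∫⁻ u, (Set.Iio R).indicator (fun v => ENNReal.ofReal v ^ (-α)) |u| =
      ENNReal.ofReal (2 / (1 - α)) * ENNReal.ofReal R ^ (1 - α) := by
  rw [lintegral_comp_abs _ (Measurable.indicator (by fun_prop) measurableSet_Iio),
    setLIntegral_indicator measurableSet_Iio, Set.Iio_inter_Ioi]
  have e : ∫⁻ v in Set.Ioo 0 R, ENNReal.ofReal v ^ (-α) =
      ∫⁻ v in Set.Ioo 0 R, ENNReal.ofReal (v ^ (-α)) :=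
    setLIntegral_congr_fun measurableSet_Ioo fun v hv => by
      simp only [ENNReal.ofReal_rpow_of_pos hv.1]
  have hi : IntegrableOn (fun v : ℝ => v ^ (-α)) (Set.Ioo 0 R) :=
    (intervalIntegral.integrableOn_Ioo_rpow_iff hR).2 (by linarith)
  rw [e, ← ofReal_integral_eq_lintegral_ofReal hi
    ((ae_restrict_iff' measurableSet_Ioo).2 (Filter.Eventually.of_forall
      fun v hv => Real.rpow_nonneg hv.1.le _)), ← integral_Ioc_eq_integral_Ioo,
    ← intervalIntegral.integral_of_le hR.le, integral_rpow (Or.inl (by linarith)),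
    Real.zero_rpow (by linarith), ENNReal.ofReal_rpow_of_pos hR,
    ← ENNReal.ofReal_mul (by apply div_nonneg <;> linarith)]
  rw [← ENNReal.ofReal_ofNat 2, ← ENNReal.ofReal_mul (by norm_num)]
  congr 1
  rw [show -α + 1 = 1 - α by ring]
  ring

lemma lintegral_rieszKernel_far {β : ℝ} (h1 : 1 < β) {R : ℝ} (hR : 0 < R) :
    ∫⁻ u, (Set.Ici R).indicator (fun v => ENNReal.ofReal v ^ (-β)) |u| =
      ENNReal.ofReal (2 / (β - 1)) * ENNReal.ofReal R ^ (1 - β) := by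
  rw [lintegral_comp_abs _ (Measurable.indicator (by fun_prop) measurableSet_Ici),
    setLIntegral_indicator measurableSet_Ici, Set.inter_eq_left.2
      (show Set.Ici R ⊆ Set.Ioi 0 from fun x hx => lt_of_lt_of_le hR hx), setLIntegral_congr Ioi_ae_eq_Ici.symm]
  have e : ∫⁻ v in Set.Ioi R, ENNReal.ofReal v ^ (-β) =
      ∫⁻ v in Set.Ioi R, ENNReal.ofReal (v ^ (-β)) :=
    setLIntegral_congr_fun measurableSet_Ioi fun v hv => by
      simp only [ENNReal.ofReal_rpow_of_pos (hR.trans hv)]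
  rw [e, ← ofReal_integral_eq_lintegral_ofReal (integrableOn_Ioi_rpow_of_lt (by linarith) hR)
    ((ae_restrict_iff' measurableSet_Ioi).2 (Filter.Eventually.of_forall
      fun v hv => Real.rpow_nonneg (hR.trans hv).le _)),
    integral_Ioi_rpow_of_lt (by linarith) hR, ENNReal.ofReal_rpow_of_pos hR,
    ← ENNReal.ofReal_mul (by apply div_nonneg <;> linarith),
    ← ENNReal.ofReal_ofNat 2, ← ENNReal.ofReal_mul (by norm_num)]
  congr 1
  rw [show -β + 1 = 1 - β by ring]
  have : 1 - β ≠ 0 := by linarith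
  have : β - 1 ≠ 0 := by linarith
  field_simp
  ring

lemma rieszKernel_split (α R u : ℝ) : rieszKernel α u =
    (Set.Iio R).indicator (fun v => ENNReal.ofReal v ^ (-α)) |u| +
      (Set.Ici R).indicator (fun v => ENNReal.ofReal v ^ (-α)) |u| := by
  rcases lt_or_ge |u| R with h | h
  · simp [rieszKernel, Set.indicator, h, not_le.2 h]
  · simp [rieszKernel, Set.indicator, h, not_lt.2 h]

lemma lintegral_sub_left (f : ℝ → ℝ≥0∞) (s : ℝ) : ∫⁻ t, f (s - t) = ∫⁻ u, f u :=
  lintegral_sub_left_eq_self f s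

/-- Pointwise bound of the fractional integral of a function that is bounded by `A`. -/
lemma lintegral_mul_rieszKernel_le {α : ℝ} (h0 : 0 < α) (h1 : α < 1) {h : ℝ → ℝ≥0∞}
    (hm : Measurable h) {A I : ℝ≥0∞} (hA0 : A ≠ 0) (hA : A ≠ ∞) (hI0 : I ≠ 0) (hI : I ≠ ∞)
    (hhA : ∀ t, h t ≤ A) (hhI : ∫⁻ t, h t ^ (2 / (2 - α)) ≤ I) (s : ℝ) :
    ∫⁻ t, h t * rieszKernel α (s - t) ≤
      (ENNReal.ofReal (2 / (1 - α)) + 2) * (A ^ (2 / (2 - α) - 1) * I ^ (1 - α)) := by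
  set r : ℝ := 2 / (2 - α) with hr
  have h2 : 0 < 2 - α := by linarith
  have hr0 : 0 < r := by positivity
  have hrA : r * (1 - α) = 2 - r := by rw [hr]; field_simp; ring
  have hrB : r * (α / 2) = r - 1 := by rw [hr]; field_simp; ring
  have hAr0 : A ^ r ≠ 0 := (ENNReal.rpow_pos (pos_iff_ne_zero.2 hA0) hA).ne'
  have hAr : A ^ r ≠ ∞ := ENNReal.rpow_ne_top_of_nonneg hr0.le hA
  -- The kernel is cut at the length I / A^r that balances two bounds. Near the origin h ≤ A is
  -- used; away from it Hölder's inequality with exponents r and 2/α, which turns the kernel into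
  -- |u|⁻². Both give A^(r-1) I^(1-α) up to a constant.
  set R' : ℝ≥0∞ := I / A ^ r with hR'
  have hR'0 : R' ≠ 0 := ENNReal.div_ne_zero.2 ⟨hI0, hAr⟩
  have hR't : R' ≠ ∞ := ENNReal.div_ne_top hI hAr0
  set R : ℝ := R'.toReal
  have hR : 0 < R := ENNReal.toReal_pos hR'0 hR't
  have hRR : ENNReal.ofReal R = R' := ENNReal.ofReal_toReal hR't
  have key (x : ℝ) : R' ^ x = I ^ x * A ^ (-(r * x)) := by
    rw [hR', div_eq_mul_inv, ENNReal.mul_rpow_of_ne_top hI (ENNReal.inv_ne_top.2 hAr0),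
      ← ENNReal.rpow_neg, ← ENNReal.rpow_mul]
    congr 2; ring
  simp_rw [rieszKernel_split α R, mul_add]
  have mn : Measurable fun u : ℝ => (Set.Iio R).indicator (fun v => ENNReal.ofReal v ^ (-α)) |u| :=
    (Measurable.indicator (by fun_prop) measurableSet_Iio).comp measurable_norm
  have mf (β : ℝ) :
      Measurable fun u : ℝ => (Set.Ici R).indicator (fun v => ENNReal.ofReal v ^ (-β)) |u| :=
    (Measurable.indicator (by fun_prop) measurableSet_Ici).comp measurable_norm
  have ma : Measurable fun t => h t * (Set.Iio R).indicator
      (fun v => ENNReal.ofReal v ^ (-α)) |s - t| :=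
    hm.mul (mn.comp (measurable_const.sub measurable_id))
  rw [lintegral_add_left ma, add_mul]
  gcongr
  · calc _ ≤ ∫⁻ t, A * (Set.Iio R).indicator (fun v => ENNReal.ofReal v ^ (-α)) |s - t| := by
          gcongr with t; exact hhA t
      _ = A * (ENNReal.ofReal (2 / (1 - α)) * ENNReal.ofReal R ^ (1 - α)) := by
          rw [lintegral_const_mul' _ _ hA, lintegral_sub_left
            (fun u => (Set.Iio R).indicator (fun v => ENNReal.ofReal v ^ (-α)) |u|),
            lintegral_rieszKernel_near h1 hR]
      _ = ENNReal.ofReal (2 / (1 - α)) * (A * A ^ (-(r * (1 - α))) * I ^ (1 - α)) := by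
          rw [hRR, key]; ring
      _ = _ := by
          congr 2
          nth_rw 1 [← ENNReal.rpow_one A]
          rw [← ENNReal.rpow_add _ _ hA0 hA, hrA]
          congr 1; ring
  · have hc : r.HolderConjugate (2 / α) := by
      rw [Real.holderConjugate_iff]
      refine ⟨?_, ?_⟩
      · rw [hr, lt_div_iff₀ h2]; linarith
      · rw [hr]; field_simp; ring
    have e2 : ∫⁻ t, ((Set.Ici R).indicator (fun v => ENNReal.ofReal v ^ (-α)) |s - t|) ^ (2 / α) =
        2 * R'⁻¹ := by
      have : (fun u : ℝ => ((Set.Ici R).indicator (fun v => ENNReal.ofReal v ^ (-α)) |u|)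
          ^ (2 / α)) = fun u => (Set.Ici R).indicator (fun v => ENNReal.ofReal v ^ (-(2 : ℝ))) |u| := by
        funext u
        rcases lt_or_ge |u| R with h | h
        · simp [Set.indicator, not_le.2 h, h0]
        · simp only [Set.indicator, Set.mem_Ici, h, if_true]
          rw [← ENNReal.rpow_mul]
          congr 1; field_simp
      rw [lintegral_sub_left (fun u => ((Set.Ici R).indicator
        (fun v => ENNReal.ofReal v ^ (-α)) |u|) ^ (2 / α)), this,
        lintegral_rieszKernel_far (by norm_num) hR, hRR, ← ENNReal.rpow_neg_one]
      norm_num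
    calc _ ≤ (∫⁻ t, h t ^ r) ^ (1 / r) * (∫⁻ t, ((Set.Ici R).indicator
            (fun v => ENNReal.ofReal v ^ (-α)) |s - t|) ^ (2 / α)) ^ (1 / (2 / α)) :=
          ENNReal.lintegral_mul_le_Lp_mul_Lq volume hc hm.aemeasurable
            ((mf α).comp (by fun_prop)).aemeasurable
      _ ≤ I ^ (1 / r) * (2 * R'⁻¹) ^ (α / 2) := by
          rw [e2, one_div_div 2 α]
          exact mul_le_mul' (ENNReal.rpow_le_rpow hhI (by positivity)) le_rfl
      _ = 2 ^ (α / 2) * (I ^ (1 / r) * R' ^ (-(α / 2))) := by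
          rw [ENNReal.mul_rpow_of_nonneg _ _ (by positivity), ENNReal.inv_rpow, ENNReal.rpow_neg]
          ring
      _ = 2 ^ (α / 2) * (A ^ (r - 1) * I ^ (1 - α)) := by
          rw [key, ← mul_assoc (I ^ (1 / r)), ← ENNReal.rpow_add _ _ hI0 hI,
            show -(r * -(α / 2)) = r - 1 by rw [← hrB]; ring,
            show 1 / r + -(α / 2) = 1 - α by rw [hr]; field_simp; ring]
          ring
      _ ≤ _ := by
          gcongr
          calc (2 : ℝ≥0∞) ^ (α / 2) ≤ 2 ^ (1 : ℝ) :=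
                ENNReal.rpow_le_rpow_of_exponent_le (by norm_num) (by linarith)
            _ = 2 := by simp

/-- The diagonal case of the Hardy–Littlewood–Sobolev inequality on the line. -/
theorem lintegral_lintegral_rieszKernel_le {α : ℝ} (h0 : 0 ≤ α) (h1 : α < 1) {f : ℝ → ℝ≥0∞}
    (hf : Measurable f) :
    ∫⁻ s, ∫⁻ t, f s * f t * rieszKernel α (s - t) ≤
      2 * (ENNReal.ofReal (2 / (1 - α)) + 2) * (∫⁻ t, f t ^ (2 / (2 - α))) ^ (2 - α) := by
  have mk : Measurable fun v : ℝ × ℝ => rieszKernel α (v.1 - v.2) :=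
    (measurable_rieszKernel α).comp (by fun_prop)
  rcases h0.eq_or_lt with rfl | h0
  · have : ∀ s, ∫⁻ t, f s * f t * rieszKernel 0 (s - t) = f s * ∫⁻ t, f t := fun s => by
      simp only [rieszKernel, neg_zero, ENNReal.rpow_zero, mul_one]
      exact lintegral_const_mul _ hf
    simp_rw [this]
    rw [lintegral_mul_const _ hf]
    norm_num
    rw [← pow_two]
    refine le_mul_of_one_le_left zero_le ?_
    norm_num
  set I := ∫⁻ t, f t ^ (2 / (2 - α)) with hI
  have h2 : 0 < 2 - α := by linarith
  have hr0 : 0 < 2 / (2 - α) := by positivity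
  by_cases hIt : I = ∞
  · rw [hIt, ENNReal.top_rpow_of_pos h2, ENNReal.mul_top (by simp)]
    exact le_top
  by_cases hI0 : I = 0
  · have : f =ᵐ[volume] 0 := by
      rw [hI, lintegral_eq_zero_iff (by fun_prop)] at hI0
      filter_upwards [hI0] with t ht
      simpa [ENNReal.rpow_eq_zero_iff, hr0, hr0.le, not_lt.2 hr0.le] using ht
    have : ∫⁻ s, ∫⁻ t, f s * f t * rieszKernel α (s - t) = 0 := by
      rw [lintegral_eq_zero_iff (Measurable.lintegral_prod_right' (f := fun v : ℝ × ℝ =>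
        f v.1 * f v.2 * rieszKernel α (v.1 - v.2)) (by fun_prop))]
      filter_upwards [this] with s hs
      simp [hs]
    rw [this]; exact zero_le
  -- The kernel is even, so the region f t ≤ f s carries half of the bound. There f may be truncated
  -- at the height A = f s, and the pointwise estimate times f s is a multiple of f s ^ r with r =
  -- 2/(2-α), which is integrable in s.
  let H : ℝ × ℝ → ℝ≥0∞ := fun v => if f v.2 ≤ f v.1 then
    f v.1 * f v.2 * rieszKernel α (v.1 - v.2) else 0
  have mH : Measurable H := Measurable.ite (measurableSet_le (by fun_prop) (by fun_prop))
    (by fun_prop) measurable_const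
  have half : ∫⁻ s, ∫⁻ t, H (s, t) ≤ (ENNReal.ofReal (2 / (1 - α)) + 2) * I ^ (2 - α) := by
    calc ∫⁻ s, ∫⁻ t, H (s, t)
        ≤ ∫⁻ s, (ENNReal.ofReal (2 / (1 - α)) + 2) * I ^ (1 - α) * f s ^ (2 / (2 - α)) := by
          apply lintegral_mono_ae
          have fin : ∀ᵐ s, f s ^ (2 / (2 - α)) < ∞ := ae_lt_top (by fun_prop) hIt
          filter_upwards [fin] with s hs
          have hst : f s ≠ ∞ := fun h => by simp [h, hr0] at hs
          by_cases hs0 : f s = 0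
          · simp [H, hs0]
          have := lintegral_mul_rieszKernel_le h0 h1 (h := fun t => if f t ≤ f s then f t else 0)
            (Measurable.ite (measurableSet_le hf measurable_const) hf measurable_const)
            hs0 hst hI0 hIt (fun t => by split_ifs with h; exacts [h, zero_le])
            (lintegral_mono fun t => by
              split_ifs
              · exact le_rfl
              · simp [hr0]) s
          calc ∫⁻ t, H (s, t) = f s * ∫⁻ t, (if f t ≤ f s then f t else 0) *
                rieszKernel α (s - t) := by
                rw [← lintegral_const_mul]
                · refine lintegral_congr fun t => ?_
                  simp only [H]
                  split_ifs
                  · ring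
                  · simp
                · exact (Measurable.ite (measurableSet_le hf measurable_const) hf
                    measurable_const).mul ((measurable_rieszKernel α).comp (by fun_prop))
            _ ≤ f s * ((ENNReal.ofReal (2 / (1 - α)) + 2) *
                (f s ^ (2 / (2 - α) - 1) * I ^ (1 - α))) := by gcongr
            _ = (ENNReal.ofReal (2 / (1 - α)) + 2) * I ^ (1 - α) *
                (f s ^ (1 : ℝ) * f s ^ (2 / (2 - α) - 1)) := by
                rw [ENNReal.rpow_one]; ring
            _ = _ := by rw [← ENNReal.rpow_add _ _ hs0 hst]; congr 2; ring
      _ = (ENNReal.ofReal (2 / (1 - α)) + 2) * (I ^ (1 - α) * I ^ (1 : ℝ)) := by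
          rw [lintegral_const_mul _ (by fun_prop), ENNReal.rpow_one]; ring
      _ = _ := by rw [← ENNReal.rpow_add _ _ hI0 hIt]; congr 2; ring
  calc ∫⁻ s, ∫⁻ t, f s * f t * rieszKernel α (s - t)
      ≤ ∫⁻ s, ∫⁻ t, (H (s, t) + H (t, s)) := by
        refine lintegral_mono fun s => lintegral_mono fun t => ?_
        rcases le_total (f t) (f s) with h | h
        · exact le_add_right (by simp [H, h])
        · refine le_add_left ?_
          simp only [H, h, if_true]
          rw [← rieszKernel_neg, neg_sub, mul_comm (f s)]
    _ = (∫⁻ s, ∫⁻ t, H (s, t)) + ∫⁻ s, ∫⁻ t, H (t, s) := by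
        rw [← lintegral_add_left mH.lintegral_prod_right']
        exact lintegral_congr fun s => lintegral_add_left (by fun_prop) _
    _ = (∫⁻ s, ∫⁻ t, H (s, t)) + ∫⁻ s, ∫⁻ t, H (s, t) := by
        congr 1
        exact lintegral_lintegral_swap (f := fun s t => H (t, s))
          (mH.comp measurable_swap).aemeasurable
    _ ≤ _ := by rw [← two_mul, mul_assoc]; gcongr

/-! ### Mixed norms: Fubini and Fatou -/

/-- The splitting of `ℝ³` into `(x, y)` and `z`. -/
def splitEquiv : (ℝ × ℝ) × ℝ ≃ᵐ R3 where
  toFun v := !₂[v.1.1, v.1.2, v.2]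
  invFun x := ((x 0, x 1), x 2)
  left_inv v := by simp
  right_inv x := by ext i; fin_cases i <;> simp
  measurable_toFun := by
    refine (PiLp.continuous_toLp 2 _).measurable.comp (measurable_pi_lambda _ fun i => ?_)
    fin_cases i <;> simp <;> fun_prop
  measurable_invFun := by
    simp only [Equiv.coe_fn_symm_mk]
    fun_prop

lemma splitEquiv_apply (w : ℝ × ℝ) (z : ℝ) : splitEquiv (w, z) = !₂[w.1, w.2, z] := rfl

lemma measurePreserving_splitEquiv : MeasurePreserving splitEquiv volume volume := by
  have h1 := (volume_preserving_piFinSuccAbove (fun _ : Fin 3 => ℝ) 2).symm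
  have h2 := (volume_preserving_finTwoArrow ℝ).symm
  have h3' : MeasurePreserving ((Prod.swap : (Fin 2 → ℝ) × ℝ → ℝ × (Fin 2 → ℝ)) ∘
      Prod.map (MeasurableEquiv.finTwoArrow (α := ℝ)).symm (id : ℝ → ℝ)) volume volume :=
    Measure.measurePreserving_swap.comp (h2.prod (MeasurePreserving.id (volume : Measure ℝ)))
  have h4 := (PiLp.volume_preserving_toLp (Fin 3)).comp (h1.comp h3')
  have e : (splitEquiv : (ℝ × ℝ) × ℝ → R3) = WithLp.toLp 2 ∘
      (MeasurableEquiv.piFinSuccAbove (fun _ : Fin 3 => ℝ) 2).symm ∘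
      (Prod.swap : (Fin 2 → ℝ) × ℝ → ℝ × (Fin 2 → ℝ)) ∘
      Prod.map (MeasurableEquiv.finTwoArrow (α := ℝ)).symm (id : ℝ → ℝ) := by
    funext v
    ext i
    fin_cases i <;> rfl
  rw [e]
  exact h4

/-- The `L²_z` norm as a function of `(x, y)`. -/
def zNorm (f : R3 → ℂ) (w : ℝ × ℝ) : ℝ≥0∞ := eLpNorm (fun z : ℝ => f (splitEquiv (w, z))) 2 volume

lemma spaceNorm_eq (p : ℝ≥0∞) (f : R3 → ℂ) : spaceNorm p f = eLpNorm (zNorm f) p volume := rfl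

lemma zNorm_sq (f : R3 → ℂ) (w : ℝ × ℝ) :
    zNorm f w ^ (2 : ℝ) = ∫⁻ z, ‖f (splitEquiv (w, z))‖ₑ ^ (2 : ℝ) := by
  rw [zNorm, eLpNorm_eq_lintegral_rpow_enorm_toReal (by norm_num) (by norm_num), ← ENNReal.rpow_mul]
  simp

lemma zNorm_eq (f : R3 → ℂ) (w : ℝ × ℝ) :
    zNorm f w = (∫⁻ z, ‖f (splitEquiv (w, z))‖ₑ ^ (2 : ℝ)) ^ (1 / 2 : ℝ) := by
  rw [zNorm, eLpNorm_eq_lintegral_rpow_enorm_toReal (by norm_num) (by norm_num)]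
  simp

lemma measurable_zNorm {f : R3 → ℂ} (hf : Measurable f) : Measurable (zNorm f) := by
  simp_rw [funext (zNorm_eq f)]
  refine Measurable.pow_const (Measurable.lintegral_prod_right' (f := fun v : (ℝ × ℝ) × ℝ =>
    ‖f (splitEquiv v)‖ₑ ^ (2 : ℝ)) ?_) _
  fun_prop

lemma lintegral_splitEquiv (f : R3 → ℝ≥0∞) (hf : Measurable f) :
    ∫⁻ w : ℝ × ℝ, ∫⁻ z : ℝ, f (splitEquiv (w, z)) = ∫⁻ x, f x := by
  rw [← measurePreserving_splitEquiv.lintegral_comp hf, Measure.volume_eq_prod (ℝ × ℝ) ℝ,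
    lintegral_prod _ (by fun_prop)]

lemma ae_splitEquiv {P : R3 → Prop} (h : ∀ᵐ x, P x) :
    ∀ᵐ w : ℝ × ℝ, ∀ᵐ z : ℝ, P (splitEquiv (w, z)) := by
  have := measurePreserving_splitEquiv.quasiMeasurePreserving.ae h
  rw [Measure.volume_eq_prod (ℝ × ℝ) ℝ] at this
  exact Measure.ae_ae_of_ae_prod this

lemma zNorm_congr_ae {f g : R3 → ℂ} (h : f =ᵐ[volume] g) : zNorm f =ᵐ[volume] zNorm g := by
  filter_upwards [ae_splitEquiv h] with w hw
  exact eLpNorm_congr_ae hw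

lemma spaceNorm_congr_ae (p : ℝ≥0∞) {f g : R3 → ℂ} (h : f =ᵐ[volume] g) :
    spaceNorm p f = spaceNorm p g :=
  eLpNorm_congr_ae (zNorm_congr_ae h)

lemma spaceNorm_eq_lintegral {p : ℝ} (hp : 0 < p) (f : R3 → ℂ) :
    spaceNorm (ENNReal.ofReal p) f = (∫⁻ w, zNorm f w ^ p) ^ (1 / p) := by
  rw [spaceNorm_eq, eLpNorm_eq_lintegral_rpow_enorm_toReal (by simpa using hp) (by simp),
    ENNReal.toReal_ofReal hp.le]
  simp

lemma spaceNorm_two {f : R3 → ℂ} (hf : AEStronglyMeasurable f volume) :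
    spaceNorm 2 f = eLpNorm f 2 volume := by
  rw [spaceNorm_congr_ae 2 hf.ae_eq_mk, eLpNorm_congr_ae hf.ae_eq_mk]
  have hm : Measurable (hf.mk f) := hf.stronglyMeasurable_mk.measurable
  have := spaceNorm_eq_lintegral (p := 2) (by norm_num) (hf.mk f)
  rw [ENNReal.ofReal_ofNat] at this
  rw [this, eLpNorm_eq_lintegral_rpow_enorm_toReal (by norm_num) (by norm_num)]
  simp_rw [zNorm_sq]
  rw [lintegral_splitEquiv (fun x => ‖hf.mk f x‖ₑ ^ (2 : ℝ)) (by fun_prop)]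
  simp

/-- A positive power is an order isomorphism of [0, ∞], hence commutes with lower limits. -/
lemma rpow_liminf {p : ℝ} (hp : 0 < p) (u : ℕ → ℝ≥0∞) :
    Filter.liminf u Filter.atTop ^ p = Filter.liminf (fun n => u n ^ p) Filter.atTop := by
  refine ((ENNReal.strictMono_rpow_of_pos hp).orderIsoOfSurjective _
    (ENNReal.rpow_left_bijective hp.ne').2).liminf_apply ?_ ?_ ?_ ?_
  all_goals isBoundedDefault

lemma lintegral_rpow_liminf_le {β : Type*} [MeasurableSpace β] {μ : Measure β} {p : ℝ} (hp : 0 < p)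
    {f : ℕ → β → ℝ≥0∞} (hf : ∀ n, AEMeasurable (f n) μ) {g : β → ℝ≥0∞}
    (h : ∀ᵐ x ∂μ, g x ≤ Filter.liminf (fun n => f n x) Filter.atTop) :
    (∫⁻ x, g x ^ p ∂μ) ^ (1 / p) ≤
      Filter.liminf (fun n => (∫⁻ x, f n x ^ p ∂μ) ^ (1 / p)) Filter.atTop := by
  rw [← rpow_liminf (by positivity)]
  refine ENNReal.rpow_le_rpow ?_ (by positivity)
  refine le_trans (lintegral_mono_ae ?_) (lintegral_liminf_le' fun n => (hf n).pow_const p)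
  filter_upwards [h] with x hx
  rw [← rpow_liminf hp]
  exact ENNReal.rpow_le_rpow hx hp.le

/-- Fatou's lemma for the mixed norm. -/
lemma spaceNorm_le_liminf {p : ℝ} (hp : 0 < p) {f : ℕ → R3 → ℂ} {g : R3 → ℂ}
    (hf : ∀ n, Measurable (f n))
    (h : ∀ᵐ x, Filter.Tendsto (fun n => f n x) Filter.atTop (nhds (g x))) :
    spaceNorm (ENNReal.ofReal p) g ≤
      Filter.liminf (fun n => spaceNorm (ENNReal.ofReal p) (f n)) Filter.atTop := by
  simp_rw [spaceNorm_eq_lintegral hp]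
  refine lintegral_rpow_liminf_le hp (fun n => (measurable_zNorm (hf n)).aemeasurable) ?_
  filter_upwards [ae_splitEquiv h] with w hw
  exact Lp.eLpNorm_lim_le_liminf_eLpNorm
    (fun n => ((hf n).comp (by fun_prop)).aestronglyMeasurable) _ hw

/-- Lower semicontinuity of the mixed norm on `L²`. -/
lemma lowerSemicontinuous_spaceNorm {p : ℝ} (hp : 0 < p) :
    LowerSemicontinuous fun f : L2 => spaceNorm (ENNReal.ofReal p) f := by
  rw [lowerSemicontinuous_iff_isClosed_preimage]
  intro a
  refine IsSeqClosed.isClosed fun f g hf hfg => ?_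
  -- Sublevel sets are sequentially closed: a sequence converging in L² has a subsequence converging
  -- almost everywhere, to which Fatou's lemma applies.
  obtain ⟨ns, -, hns⟩ := (tendstoInMeasure_of_tendsto_Lp hfg).exists_seq_tendsto_ae
  refine (spaceNorm_le_liminf hp (fun n => (Lp.stronglyMeasurable (f (ns n))).measurable)
    hns).trans ?_
  exact Filter.liminf_le_of_le (by isBoundedDefault) fun b hb =>
    let ⟨n, hn⟩ := hb.exists
    hn.trans (hf (ns n))

/-! ### The unitary group on L² -/

lemma fourier_U (t : ℝ) (f : L2) :
    (𝓕 (U t f) : L2) =ᵐ[volume] fun ξ => symbol t ξ * (𝓕 f : L2) ξ := by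
  rw [U, FourierTransform.fourier_fourierInv_eq]
  exact MemLp.coeFn_toLp _

lemma fourier_injective {f g : L2} (h : (𝓕 f : L2) =ᵐ[volume] (𝓕 g : L2)) : f = g :=
  (Lp.fourierTransformₗᵢ R3 ℂ).injective (Lp.ext h)

lemma U_add (t : ℝ) (f g : L2) : U t (f + g) = U t f + U t g := by
  apply fourier_injective
  rw [FourierTransform.fourier_add (U t f) (U t g)]
  filter_upwards [fourier_U t (f + g), fourier_U t f, fourier_U t g,
    Lp.coeFn_add (𝓕 f : L2) (𝓕 g : L2), Lp.coeFn_add (𝓕 (U t f) : L2) (𝓕 (U t g) : L2)]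
    with ξ h1 h2 h3 h4 h5
  rw [h1, h5, Pi.add_apply, h2, h3, FourierTransform.fourier_add f g, h4, Pi.add_apply, mul_add]

lemma U_smul (t : ℝ) (c : ℂ) (f : L2) : U t (c • f) = c • U t f := by
  apply fourier_injective
  rw [FourierTransform.fourier_smul c (U t f)]
  filter_upwards [fourier_U t (c • f), fourier_U t f,
    Lp.coeFn_smul c (𝓕 f : L2), Lp.coeFn_smul c (𝓕 (U t f) : L2)] with ξ h1 h2 h4 h5
  rw [h1, h5, Pi.smul_apply, h2, FourierTransform.fourier_smul c f, h4, Pi.smul_apply]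
  simp only [smul_eq_mul]
  ring

lemma U_zero (f : L2) : U 0 f = f := by
  apply fourier_injective
  filter_upwards [fourier_U 0 f] with ξ h
  rw [h]
  simp [symbol, phase]

lemma inner_eq_integral_fourier (f g : L2) :
    inner ℂ f g = ∫ ξ, starRingEnd ℂ ((𝓕 f : L2) ξ) * (𝓕 g : L2) ξ := by
  rw [← Lp.inner_fourier_eq, L2.inner_def]
  refine integral_congr_ae (.of_forall fun ξ => ?_)
  simp only
  rw [RCLike.inner_apply, mul_comm]

lemma inner_U (t : ℝ) (f g : L2) : inner ℂ f (U t g) =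
    ∫ ξ, symbol t ξ * (starRingEnd ℂ ((𝓕 f : L2) ξ) * (𝓕 g : L2) ξ) := by
  rw [inner_eq_integral_fourier]
  apply integral_congr_ae
  filter_upwards [fourier_U t g] with ξ h
  rw [h]
  ring

lemma conj_symbol_mul (a b : ℝ) (ξ : R3) :
    starRingEnd ℂ (symbol a ξ) * symbol b ξ = symbol (b - a) ξ := by
  have h : phase (b - a) ξ = -phase a ξ + phase b ξ := by simp only [phase]; ring
  simp only [symbol, ← Complex.exp_conj, ← Complex.exp_add, h]
  congr 1
  simp
  ring

/-- On the Fourier side the conjugate of `symbol a` times `symbol b` is `symbol (b - a)`. This one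
identity contains unitarity and the adjoint relation, and it is the form that TT* needs. -/
lemma inner_U_U (a b : ℝ) (f g : L2) : inner ℂ (U a f) (U b g) = inner ℂ f (U (b - a) g) := by
  rw [inner_U, inner_U]
  apply integral_congr_ae
  filter_upwards [fourier_U a f] with ξ h
  rw [h, map_mul, ← conj_symbol_mul]
  ring

lemma inner_U_left (a : ℝ) (f g : L2) : inner ℂ (U a f) g = inner ℂ f (U (-a) g) := by
  have := inner_U_U a 0 f g
  rwa [U_zero, zero_sub] at this

lemma norm_U (t : ℝ) (f : L2) : ‖U t f‖ = ‖f‖ := by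
  rw [norm_eq_sqrt_re_inner (𝕜 := ℂ), norm_eq_sqrt_re_inner (𝕜 := ℂ) f, inner_U_U, sub_self, U_zero]

/-- The group as linear isometries. -/
def UL (t : ℝ) : L2 →ₗᵢ[ℂ] L2 where
  toFun := U t
  map_add' := U_add t
  map_smul' := U_smul t
  norm_map' := norm_U t

@[simp] lemma UL_apply (t : ℝ) (f : L2) : UL t f = U t f := rfl

lemma integrable_fourier_mul (f g : L2) :
    Integrable fun ξ => starRingEnd ℂ ((𝓕 f : L2) ξ) * (𝓕 g : L2) ξ := by
  refine (L2.integrable_inner (𝕜 := ℂ) (𝓕 f : L2) (𝓕 g : L2)).congr (.of_forall fun ξ => ?_)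
  simp only
  rw [RCLike.inner_apply, mul_comm]

lemma continuous_inner_U (f g : L2) : Continuous fun t => inner ℂ f (U t g) := by
  simp_rw [inner_U]
  refine continuous_of_dominated (bound := fun ξ => ‖starRingEnd ℂ ((𝓕 f : L2) ξ) * (𝓕 g : L2) ξ‖)
    (fun t => ?_) (fun t => .of_forall fun ξ => ?_) (integrable_fourier_mul f g).norm
    (.of_forall fun ξ => ?_)
  · exact (continuous_symbol t).aestronglyMeasurable.mul
      (integrable_fourier_mul f g).aestronglyMeasurable
  · rw [norm_mul, norm_symbol, one_mul]
  · unfold symbol phase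
    fun_prop

lemma continuous_U_apply (f : L2) : Continuous fun t => U t f := by
  rw [continuous_iff_continuousAt]
  intro s
  rw [ContinuousAt, tendsto_iff_norm_sub_tendsto_zero]
  -- For isometries, strong continuity reduces to continuity of the matrix coefficient ⟨f, U(s-t)f⟩
  -- by expanding the square.
  have h (t : ℝ) : ‖U t f - U s f‖ =
      Real.sqrt (2 * ‖f‖ ^ 2 - 2 * RCLike.re (inner ℂ f (U (s - t) f))) := by
    rw [← Real.sqrt_sq (norm_nonneg _), @norm_sub_sq ℂ, norm_U, norm_U, inner_U_U]
    congr 1; ring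
  simp_rw [h]
  have : Continuous fun t =>
      Real.sqrt (2 * ‖f‖ ^ 2 - 2 * RCLike.re (inner ℂ f (U (s - t) f))) := by
    have := (continuous_inner_U f f).comp (continuous_sub_left s)
    exact (continuous_const.sub (continuous_const.mul (RCLike.continuous_re.comp this))).sqrt
  have h2 := this.tendsto s
  simp only [sub_self, U_zero] at h2
  convert h2 using 2
  rw [inner_self_eq_norm_sq (𝕜 := ℂ)]
  simp

/-- Strong continuity becomes joint continuity because every `U t` is isometric. It is what makes t
↦ U(-t)G(t) strongly measurable. -/
lemma continuous_U : Continuous fun v : ℝ × L2 => U v.1 v.2 := by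
  rw [continuous_iff_continuousAt]
  rintro ⟨s, f⟩
  rw [ContinuousAt, tendsto_iff_norm_sub_tendsto_zero]
  have h1 : Filter.Tendsto (fun v : ℝ × L2 => ‖v.2 - f‖ + ‖U v.1 f - U s f‖) (nhds (s, f))
      (nhds 0) := by
    have hc : Continuous fun v : ℝ × L2 => ‖v.2 - f‖ + ‖U v.1 f - U s f‖ :=
      ((continuous_snd.sub continuous_const).norm).add
        ((((continuous_U_apply f).comp continuous_fst).sub continuous_const).norm)
    simpa using hc.tendsto (s, f)
  refine squeeze_zero (fun _ => norm_nonneg _) (fun v => ?_) h1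
  have : U v.1 v.2 - U s f = U v.1 (v.2 - f) + (U v.1 f - U s f) := by
    have := (UL v.1).map_sub v.2 f
    simp only [UL_apply] at this
    rw [this]; abel
  rw [this]
  refine (norm_add_le _ _).trans ?_
  rw [norm_U]

lemma measurable_spaceNorm_U {p : ℝ} (hp : 0 < p) (f : L2) :
    Measurable fun t => spaceNorm (ENNReal.ofReal p) (U t f) :=
  LowerSemicontinuous.measurable
    ((lowerSemicontinuous_spaceNorm hp).comp (continuous_U_apply f))

/-! ### Schur's test and the Gaussian kernel of the damped group -/

/-- Schur's test for a convolution kernel, as a bound of a bilinear form. -/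
lemma lintegral_convolution_le {G : Type*} [AddCommGroup G] [MeasurableSpace G] [MeasurableAdd₂ G]
    [MeasurableNeg G] (μ : Measure G) [SFinite μ] [μ.IsAddLeftInvariant] [μ.IsNegInvariant]
    {f k g : G → ℝ≥0∞} (hf : Measurable f) (hk : Measurable k) (hg : Measurable g) :
    ∫⁻ x, ∫⁻ y, f x * k (x - y) * g y ∂μ ∂μ ≤
      (∫⁻ x, k x ∂μ) * ((∫⁻ x, f x ^ (2 : ℝ) ∂μ) ^ (1 / 2 : ℝ) *
        (∫⁻ x, g x ^ (2 : ℝ) ∂μ) ^ (1 / 2 : ℝ)) := by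
  have hkm : Measurable fun v : G × G => k (v.1 - v.2) := hk.comp measurable_sub
  -- Cauchy–Schwarz on the product space with k split evenly between the two factors; by invariance
  -- each factor then integrates to ∫ k times an L² norm squared.
  let F : G × G → ℝ≥0∞ := fun v => f v.1 * k (v.1 - v.2) ^ (1 / 2 : ℝ)
  let H : G × G → ℝ≥0∞ := fun v => g v.2 * k (v.1 - v.2) ^ (1 / 2 : ℝ)
  have hF : Measurable F := (hf.comp measurable_fst).mul (hkm.pow_const _)
  have hH : Measurable H := (hg.comp measurable_snd).mul (hkm.pow_const _)
  have sq (a : ℝ≥0∞) : (a ^ (1 / 2 : ℝ)) ^ (2 : ℝ) = a := by rw [← ENNReal.rpow_mul]; simp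
  have e0 : ∫⁻ x, ∫⁻ y, f x * k (x - y) * g y ∂μ ∂μ = ∫⁻ v, (F * H) v ∂(μ.prod μ) := by
    rw [lintegral_prod _ (hF.mul hH).aemeasurable]
    refine lintegral_congr fun x => lintegral_congr fun y => ?_
    simp only [F, H, Pi.mul_apply]
    calc f x * k (x - y) * g y = f x * g y * k (x - y) ^ (1 : ℝ) := by rw [ENNReal.rpow_one]; ring
      _ = f x * g y * (k (x - y) ^ (1 / 2 : ℝ) * k (x - y) ^ (1 / 2 : ℝ)) := by
          rw [← ENNReal.rpow_add_of_nonneg _ _ (by norm_num) (by norm_num)]; norm_num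
      _ = _ := by ring
  have e1 : ∫⁻ v, F v ^ (2 : ℝ) ∂(μ.prod μ) = (∫⁻ x, k x ∂μ) * ∫⁻ x, f x ^ (2 : ℝ) ∂μ := by
    rw [lintegral_prod _ (hF.pow_const _).aemeasurable]
    simp only [F, ENNReal.mul_rpow_of_nonneg _ _ (zero_le_two (α := ℝ)), sq]
    rw [mul_comm, ← lintegral_mul_const _ (hf.pow_const _)]
    refine lintegral_congr fun x => ?_
    have hx : Measurable fun y => k (x - y) := hk.comp (measurable_const.sub measurable_id)
    rw [lintegral_const_mul _ hx]
    rw [lintegral_sub_left_eq_self k x]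
  have e2 : ∫⁻ v, H v ^ (2 : ℝ) ∂(μ.prod μ) = (∫⁻ x, k x ∂μ) * ∫⁻ x, g x ^ (2 : ℝ) ∂μ := by
    rw [lintegral_prod_symm _ (hH.pow_const _).aemeasurable]
    simp only [H, ENNReal.mul_rpow_of_nonneg _ _ (zero_le_two (α := ℝ)), sq]
    rw [mul_comm, ← lintegral_mul_const _ (hg.pow_const _)]
    refine lintegral_congr fun y => ?_
    have hy : Measurable fun x => k (x - y) := hk.comp (measurable_id.sub measurable_const)
    rw [lintegral_const_mul _ hy]
    rw [lintegral_sub_right_eq_self k y]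
  rw [e0]
  refine (ENNReal.lintegral_mul_le_Lp_mul_Lq _ Real.HolderConjugate.two_two hF.aemeasurable
    hH.aemeasurable).trans_eq ?_
  rw [e1, e2, ENNReal.mul_rpow_of_nonneg _ _ (by norm_num), ENNReal.mul_rpow_of_nonneg _ _ (by norm_num)]
  calc _ = ((∫⁻ x, k x ∂μ) ^ (1 / 2 : ℝ) * (∫⁻ x, k x ∂μ) ^ (1 / 2 : ℝ)) *
        ((∫⁻ x, f x ^ (2 : ℝ) ∂μ) ^ (1 / 2 : ℝ) * (∫⁻ x, g x ^ (2 : ℝ) ∂μ) ^ (1 / 2 : ℝ)) := by ring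
    _ = _ := by
        rw [← ENNReal.rpow_add_of_nonneg _ _ (by norm_num) (by norm_num)]; norm_num

/-- The symbol of the group, damped by a Gaussian. -/
def regSymbol (ε t : ℝ) (ξ : R3) : ℂ :=
  (Real.exp (-(ε * (ξ 0 ^ 2 + ξ 1 ^ 2 + ξ 2 ^ 2))) : ℂ) * symbol t ξ

lemma continuous_regSymbol (ε t : ℝ) : Continuous (regSymbol ε t) := by
  have := continuous_symbol t
  unfold regSymbol
  fun_prop

lemma norm_regSymbol_le {ε : ℝ} (hε : 0 ≤ ε) (t : ℝ) (ξ : R3) : ‖regSymbol ε t ξ‖ ≤ 1 := by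
  rw [regSymbol, norm_mul, norm_symbol, mul_one, Complex.norm_real, Real.norm_eq_abs, Real.abs_exp,
    Real.exp_le_one_iff]
  nlinarith [mul_nonneg hε (add_nonneg (add_nonneg (sq_nonneg (ξ 0)) (sq_nonneg (ξ 1)))
    (sq_nonneg (ξ 2)))]

/-- The quadratic coefficients of the damped phase. -/
def regCoeff (ε t : ℝ) : Fin 3 → ℂ :=
  ![ε + 4 * Real.pi ^ 2 * t * Complex.I, ε + 4 * Real.pi ^ 2 * t * Complex.I, ε]

lemma regCoeff_re (ε t : ℝ) (i : Fin 3) : (regCoeff ε t i).re = ε := by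
  fin_cases i <;> simp [regCoeff, pow_two]

/-- The part of the phase that is linear in `ξ 2` merges with the Fourier exponential and shifts `v
2` to `v 2 - t`, the translation in z. What remains is a product of one-dimensional Gaussians. -/
lemma regSymbol_mul_exp (ε t : ℝ) (v ξ : Fin 3 → ℝ) :
    regSymbol ε t (WithLp.toLp 2 ξ) * Complex.exp (2 * Real.pi * Complex.I * (∑ i, v i * ξ i : ℝ)) =
      Complex.exp (-∑ i, regCoeff ε t i * (ξ i : ℂ) ^ 2 +
        ∑ i, (2 * Real.pi * Complex.I * ((![v 0, v 1, v 2 - t] : Fin 3 → ℝ) i : ℂ)) * ξ i) := by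
  rw [regSymbol, symbol, Complex.ofReal_exp, ← Complex.exp_add, ← Complex.exp_add]
  congr 1
  simp [phase, regCoeff, Fin.sum_univ_three]
  ring

/-- The convolution kernel of the damped group. -/
def regKernel (ε t : ℝ) (v : R3) : ℂ :=
  ∫ ξ : R3, regSymbol ε t ξ * Complex.exp (2 * Real.pi * Complex.I * (inner ℝ v ξ : ℝ))

lemma integrable_regSymbol {ε : ℝ} (hε : 0 < ε) (t : ℝ) : Integrable (regSymbol ε t) := by
  rw [← (PiLp.volume_preserving_toLp (Fin 3)).integrable_comp_emb
    (MeasurableEquiv.toLp 2 _).measurableEmbedding]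
  refine (GaussianFourier.integrable_cexp_neg_sum_mul_add (b := regCoeff ε t)
    (fun i => by rwa [regCoeff_re])
    (fun i => 2 * Real.pi * Complex.I * ((![0, 0, 0 - t] : Fin 3 → ℝ) i : ℂ))).congr
    (.of_forall fun ξ => ?_)
  have := regSymbol_mul_exp ε t 0 ξ
  simp only [Pi.zero_apply, zero_mul, Finset.sum_const_zero, Complex.ofReal_zero, mul_zero,
    Complex.exp_zero, mul_one] at this
  simp only [Function.comp]
  rw [this]

lemma regKernel_eq {ε : ℝ} (hε : 0 < ε) (t : ℝ) (v : R3) :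
    regKernel ε t v = ∏ i, (Real.pi / regCoeff ε t i) ^ (1 / 2 : ℂ) * Complex.exp
      ((2 * Real.pi * Complex.I * ((![v 0, v 1, v 2 - t] : Fin 3 → ℝ) i : ℂ)) ^ 2 /
        (4 * regCoeff ε t i)) := by
  rw [regKernel, ← (PiLp.volume_preserving_toLp (Fin 3)).integral_comp
    (MeasurableEquiv.toLp 2 _).measurableEmbedding,
    ← GaussianFourier.integral_cexp_neg_sum_mul_add (fun i => by rwa [regCoeff_re])]
  refine integral_congr_ae (.of_forall fun ξ => ?_)
  have := regSymbol_mul_exp ε t v.ofLp ξ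
  simp only
  rw [← this]
  congr 4
  simp [PiLp.inner_apply, mul_comm]

/-- The modulus of the exponential only sees the real part ε/|b|² of 1/b, and that of the complex
square root does not depend on its branch. -/
lemma norm_regKernel {ε : ℝ} (hε : 0 < ε) (t : ℝ) (v : R3) :
    ‖regKernel ε t v‖ = ∏ i, (Real.pi / ‖regCoeff ε t i‖) ^ (1 / 2 : ℝ) * Real.exp
      (-(Real.pi ^ 2 * ε * (![v 0, v 1, v 2 - t] : Fin 3 → ℝ) i ^ 2 /
        Complex.normSq (regCoeff ε t i))) := by
  rw [regKernel_eq hε, norm_prod]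
  refine Finset.prod_congr rfl fun i _ => ?_
  generalize (![v 0, v 1, v 2 - t] : Fin 3 → ℝ) i = u
  have hb : regCoeff ε t i ≠ 0 := fun h => by
    have := regCoeff_re ε t i
    rw [h] at this
    simp at this
    linarith
  have hre := regCoeff_re ε t i
  set b := regCoeff ε t i
  rw [norm_mul, Complex.norm_exp]
  congr 1
  · rw [show (1 / 2 : ℂ) = ((1 / 2 : ℝ) : ℂ) by push_cast; rfl, Complex.norm_cpow_real, norm_div,
      Complex.norm_real, Real.norm_of_nonneg Real.pi_pos.le]
  · have : (2 * Real.pi * Complex.I * (u : ℂ)) ^ 2 / (4 * b) =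
        ((-(Real.pi ^ 2 * u ^ 2) : ℝ) : ℂ) * b⁻¹ := by
      push_cast
      rw [mul_pow, mul_pow, Complex.I_sq]
      field_simp
      ring
    rw [this, Complex.re_ofReal_mul, Complex.inv_re, hre]
    congr 1
    ring

lemma lintegral_gaussian (ε : ℝ) (hε : 0 < ε) :
    ∫⁻ u : ℝ, ENNReal.ofReal ((Real.pi / ε) ^ (1 / 2 : ℝ) * Real.exp (-(Real.pi ^ 2 / ε * u ^ 2))) =
      1 := by
  have hi : Integrable fun u : ℝ => Real.exp (-(Real.pi ^ 2 / ε * u ^ 2)) := by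
    simpa using integrable_exp_neg_mul_sq (b := Real.pi ^ 2 / ε) (by positivity)
  rw [← ofReal_integral_eq_lintegral_ofReal (hi.const_mul _)
    (.of_forall fun u => by positivity), integral_const_mul]
  have h := integral_gaussian (Real.pi ^ 2 / ε)
  simp only [neg_mul] at h
  rw [h, ← Real.sqrt_eq_rpow, ← Real.sqrt_mul (by positivity)]
  have : Real.pi / ε * (Real.pi / (Real.pi ^ 2 / ε)) = 1 := by
    have := Real.pi_pos
    field_simp
  rw [this]
  simp

/-- The part of the kernel of the damped group that acts in `z`. -/
def zKernel (ε t : ℝ) (u : ℝ) : ℝ≥0∞ :=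
  ENNReal.ofReal ((Real.pi / ε) ^ (1 / 2 : ℝ) * Real.exp (-(Real.pi ^ 2 / ε * (u - t) ^ 2)))

lemma measurable_zKernel (ε t : ℝ) : Measurable (zKernel ε t) := by
  unfold zKernel
  fun_prop

lemma lintegral_zKernel {ε : ℝ} (hε : 0 < ε) (t : ℝ) : ∫⁻ u, zKernel ε t u = 1 := by
  rw [← lintegral_gaussian ε hε]
  exact lintegral_sub_right_eq_self (fun u => ENNReal.ofReal
    ((Real.pi / ε) ^ (1 / 2 : ℝ) * Real.exp (-(Real.pi ^ 2 / ε * u ^ 2)))) t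

/-- In x and y the coefficient has modulus at least 4π²|t|, so the two square roots multiply to at
most 1/(4π|t|), and the exponentials are dropped. In z the Gaussian is kept: its integral is 1 for
every ε, so the bound survives the removal of the damping. -/
lemma enorm_regKernel_le {ε : ℝ} (hε : 0 < ε) {t : ℝ} (ht : t ≠ 0) (v : R3) :
    ‖regKernel ε t v‖ₑ ≤ rieszKernel 1 t * zKernel ε t (v 2) := by
  have hr : rieszKernel 1 t = ENNReal.ofReal |t|⁻¹ := by
    rw [rieszKernel, ENNReal.rpow_neg_one, ENNReal.ofReal_inv_of_pos (abs_pos.2 ht)]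
  rw [hr, zKernel, ← ENNReal.ofReal_mul (by positivity), ← ofReal_norm]
  refine ENNReal.ofReal_le_ofReal ?_
  rw [norm_regKernel hε, Fin.prod_univ_three]
  have hc : ‖regCoeff ε t 0‖ ≥ 4 * Real.pi ^ 2 * |t| := by
    have := Complex.abs_im_le_norm (regCoeff ε t 0)
    refine le_trans (le_of_eq ?_) this
    simp [regCoeff, pow_two, abs_mul]
  have ha := abs_pos.2 ht
  have hpi : (3 : ℝ) < Real.pi := Real.pi_gt_three
  have hA : (Real.pi / ‖regCoeff ε t 0‖) ^ (1 / 2 : ℝ) * (Real.pi / ‖regCoeff ε t 0‖) ^ (1 / 2 : ℝ)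
      ≤ |t|⁻¹ := by
    rw [← Real.rpow_add_of_nonneg (by positivity) (by norm_num) (by norm_num)]
    norm_num
    have : 0 < 4 * Real.pi ^ 2 * |t| := by positivity
    rw [div_le_iff₀ (this.trans_le hc), inv_mul_eq_div, le_div_iff₀ ha]
    nlinarith
  have h1 : regCoeff ε t 1 = regCoeff ε t 0 := rfl
  have h2 : regCoeff ε t 2 = ε := rfl
  rw [h1, h2, Complex.norm_real, Real.norm_of_nonneg hε.le, Complex.normSq_ofReal]
  have e (u : ℝ) : Real.exp (-(Real.pi ^ 2 * ε * u ^ 2 / Complex.normSq (regCoeff ε t 0))) ≤ 1 := by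
    rw [Real.exp_le_one_iff]
    have := Complex.normSq_nonneg (regCoeff ε t 0)
    simp only [Left.neg_nonpos_iff]
    positivity
  have e2 : Real.pi ^ 2 * ε * (v 2 - t) ^ 2 / (ε * ε) = Real.pi ^ 2 / ε * (v 2 - t) ^ 2 := by
    field_simp
  simp only [Matrix.cons_val_zero, Matrix.cons_val_one, Matrix.cons_val]
  rw [e2]
  set P := (Real.pi / ‖regCoeff ε t 0‖) ^ (1 / 2 : ℝ)
  have hP : 0 ≤ P := by positivity
  refine mul_le_mul_of_nonneg_right ?_ (by positivity)
  refine le_trans (mul_le_mul (mul_le_of_le_one_right hP (e _)) (mul_le_of_le_one_right hP (e _))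
    (by positivity) hP) hA

/-- A qualitative fact for fixed ε, needed only to make the error terms of the density argument in
`enorm_regForm_le` finite. The kernel is again a Gaussian, with coefficients π²/b; expanding the
square (v 2 - t)² yields the linear term and the constant factor. -/
lemma integrable_regKernel {ε : ℝ} (hε : 0 < ε) (t : ℝ) : Integrable (regKernel ε t) := by
  have hb (i : Fin 3) : regCoeff ε t i ≠ 0 := fun h => by
    have := regCoeff_re ε t i
    rw [h] at this
    simp at this
    linarith
  have key := GaussianFourier.integrable_cexp_neg_sum_mul_add
    (b := fun i => (Real.pi ^ 2 : ℝ) * (regCoeff ε t i)⁻¹) (fun i => by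
      rw [Complex.re_ofReal_mul, Complex.inv_re, regCoeff_re]
      have := Complex.normSq_pos.2 (hb i)
      positivity)
    (![0, 0, 2 * Real.pi ^ 2 * t / ε])
  rw [← (PiLp.volume_preserving_toLp (Fin 3)).integrable_comp_emb
    (MeasurableEquiv.toLp 2 _).measurableEmbedding]
  refine (key.const_mul ((∏ i, (Real.pi / regCoeff ε t i) ^ (1 / 2 : ℂ)) *
    Complex.exp (-(Real.pi ^ 2 * t ^ 2 / ε)))).congr (.of_forall fun v => ?_)
  simp only [Function.comp]
  rw [regKernel_eq hε, Finset.prod_mul_distrib, mul_assoc, ← Complex.exp_add, ← Complex.exp_sum]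
  congr 2
  have h2 : regCoeff ε t 2 = ε := rfl
  have hb0 := hb 0
  have hb1 := hb 1
  have hb2 : (ε : ℂ) ≠ 0 := by exact_mod_cast hε.ne'
  simp only [Fin.sum_univ_three, Matrix.cons_val_zero, Matrix.cons_val_one, Matrix.cons_val, h2]
  simp only [mul_pow, Complex.I_sq]
  push_cast
  field_simp
  ring

/-! ### The dispersive estimate -/

lemma enorm_L2_eq (f : L2) : ‖f‖ₑ = (∫⁻ x, ‖f x‖ₑ ^ (2 : ℝ)) ^ (1 / 2 : ℝ) := by
  rw [Lp.enorm_def, eLpNorm_eq_lintegral_rpow_enorm_toReal (by norm_num) (by norm_num)]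
  simp

lemma memLp_mul_of_bound {m : R3 → ℂ} (hm : Continuous m) (hm1 : ∀ ξ, ‖m ξ‖ ≤ 1) (f : L2) :
    MemLp (fun ξ => m ξ * f ξ) 2 (volume : Measure R3) :=
  MemLp.of_le (Lp.memLp f) (hm.aestronglyMeasurable.mul (Lp.aestronglyMeasurable f))
    (.of_forall fun ξ => by
      rw [norm_mul]; exact mul_le_of_le_one_left (norm_nonneg _) (hm1 ξ))

/-- Multiplication by a continuous function bounded by `1`, as a linear map on `L²`. -/
def mulL2Lin (m : R3 → ℂ) (hm : Continuous m) (hm1 : ∀ ξ, ‖m ξ‖ ≤ 1) : L2 →ₗ[ℂ] L2 where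
  toFun f := (memLp_mul_of_bound hm hm1 f).toLp _
  map_add' f g := by
    apply Lp.ext
    filter_upwards [(memLp_mul_of_bound hm hm1 (f + g)).coeFn_toLp,
      (memLp_mul_of_bound hm hm1 f).coeFn_toLp, (memLp_mul_of_bound hm hm1 g).coeFn_toLp,
      Lp.coeFn_add f g, Lp.coeFn_add ((memLp_mul_of_bound hm hm1 f).toLp _)
        ((memLp_mul_of_bound hm hm1 g).toLp _)] with ξ h1 h2 h3 h4 h5
    rw [h1, h5, Pi.add_apply, h2, h3, h4, Pi.add_apply, mul_add]
  map_smul' c f := by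
    apply Lp.ext
    filter_upwards [(memLp_mul_of_bound hm hm1 (c • f)).coeFn_toLp,
      (memLp_mul_of_bound hm hm1 f).coeFn_toLp, Lp.coeFn_smul c f,
      Lp.coeFn_smul c ((memLp_mul_of_bound hm hm1 f).toLp _)] with ξ h1 h2 h4 h5
    rw [RingHom.id_apply, h1, h5, Pi.smul_apply, h2, h4, Pi.smul_apply]
    simp only [smul_eq_mul]
    ring

lemma mulL2Lin_coeFn {m : R3 → ℂ} (hm : Continuous m) (hm1 : ∀ ξ, ‖m ξ‖ ≤ 1) (f : L2) :
    mulL2Lin m hm hm1 f =ᵐ[volume] fun ξ => m ξ * f ξ :=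
  (memLp_mul_of_bound hm hm1 f).coeFn_toLp

lemma continuous_mulL2Lin {m : R3 → ℂ} (hm : Continuous m) (hm1 : ∀ ξ, ‖m ξ‖ ≤ 1) :
    Continuous (mulL2Lin m hm hm1) := by
  refine AddMonoidHomClass.continuous_of_bound (mulL2Lin m hm hm1) 1 fun f => ?_
  rw [one_mul]
  refine Lp.norm_le_norm_of_ae_le ?_
  filter_upwards [mulL2Lin_coeFn hm hm1 f] with ξ h
  rw [h, norm_mul]
  exact mul_le_of_le_one_left (norm_nonneg _) (hm1 ξ)

/-- The quadratic form of the damped group. -/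
def regForm (ε t : ℝ) (f g : L2) : ℂ :=
  ∫ ξ, regSymbol ε t ξ * (starRingEnd ℂ ((𝓕 f : L2) ξ) * (𝓕 g : L2) ξ)

lemma continuous_regForm {ε : ℝ} (hε : 0 < ε) (t : ℝ) :
    Continuous fun v : L2 × L2 => regForm ε t v.1 v.2 := by
  have : (fun v : L2 × L2 => regForm ε t v.1 v.2) = fun v => inner ℂ (𝓕 v.1 : L2)
      (mulL2Lin (regSymbol ε t) (continuous_regSymbol ε t) (norm_regSymbol_le hε.le t) (𝓕 v.2 : L2)) := by
    funext v
    rw [regForm, L2.inner_def]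
    apply integral_congr_ae
    filter_upwards [mulL2Lin_coeFn (continuous_regSymbol ε t)
      (norm_regSymbol_le hε.le t) (𝓕 v.2 : L2)] with ξ h
    rw [h, RCLike.inner_apply]
    ring
  rw [this]
  have c : Continuous fun f : L2 => (𝓕 f : L2) := (Lp.fourierTransformₗᵢ R3 ℂ).continuous
  exact (c.comp continuous_fst).inner ((continuous_mulL2Lin _ _).comp
    (c.comp continuous_snd))

/-- The bilinear form of the modulus of the kernel of the damped group. -/
def absForm (ε t : ℝ) (f g : R3 → ℂ) : ℝ≥0∞ :=
  ∫⁻ x, ∫⁻ y, ‖f x‖ₑ * ‖regKernel ε t (x - y)‖ₑ * ‖g y‖ₑ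

lemma absForm_congr_ae {ε t : ℝ} {f f' g g' : R3 → ℂ} (hf : f =ᵐ[volume] f')
    (hg : g =ᵐ[volume] g') : absForm ε t f g = absForm ε t f' g' := by
  apply lintegral_congr_ae
  filter_upwards [hf] with x hx
  apply lintegral_congr_ae
  filter_upwards [hg] with y hy
  rw [hx, hy]

lemma continuous_regKernel {ε : ℝ} (hε : 0 < ε) (t : ℝ) : Continuous (regKernel ε t) := by
  rw [funext (regKernel_eq hε t)]
  refine continuous_finsetProd _ fun i _ => ?_
  refine continuous_const.mul (Complex.continuous_exp.comp (Continuous.div_const ?_ _))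
  refine (continuous_const.mul (Complex.continuous_ofReal.comp ?_)).pow 2
  fin_cases i <;> simp <;> fun_prop

/-- The damping makes the integral over x, y and ξ absolutely convergent. Fubini's theorem
integrates ξ first, so that the oscillation is spent on the kernel before absolute values are taken.
-/
lemma enorm_integral_schwartz_le {ε : ℝ} (hε : 0 < ε) (t : ℝ) (f g : 𝓢(R3, ℂ)) :
    ‖∫ ξ, regSymbol ε t ξ * (starRingEnd ℂ (𝓕 (f : R3 → ℂ) ξ) * 𝓕 (g : R3 → ℂ) ξ)‖ₑ ≤
      absForm ε t f g := by
  let a : R3 × R3 → R3 → ℂ := fun v ξ => (starRingEnd ℂ (f v.1) * g v.2) *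
    (regSymbol ε t ξ * Complex.exp (2 * Real.pi * Complex.I * (inner ℝ (v.1 - v.2) ξ : ℝ)))
  have hfi : Integrable (fun x => starRingEnd ℂ (f x)) :=
    (LinearIsometryEquiv.integrable_comp_iff (RCLike.conjLIE (K := ℂ))).2 f.integrable
  have hfg : Integrable (fun v : R3 × R3 => starRingEnd ℂ (f v.1) * g v.2)
      (volume.prod volume) := hfi.mul_prod g.integrable
  have hb : Integrable (fun v : (R3 × R3) × R3 =>
      (starRingEnd ℂ (f v.1.1) * g v.1.2) * regSymbol ε t v.2) ((volume.prod volume).prod volume) :=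
    hfg.mul_prod (integrable_regSymbol hε t)
  have ha : Integrable (Function.uncurry a) ((volume.prod volume).prod volume) := by
    have hc : Continuous fun v : (R3 × R3) × R3 =>
        Complex.exp (2 * Real.pi * Complex.I * (inner ℝ (v.1.1 - v.1.2) v.2 : ℝ)) := by fun_prop
    refine (hb.mul_bdd (c := 1) hc.aestronglyMeasurable (.of_forall fun v => ?_)).congr
      (.of_forall fun v => ?_)
    · rw [show 2 * Real.pi * Complex.I * ((inner ℝ (v.1.1 - v.1.2) v.2 : ℝ) : ℂ) =
        ((2 * Real.pi * inner ℝ (v.1.1 - v.1.2) v.2 : ℝ) : ℂ) * Complex.I by push_cast; ring]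
      rw [Complex.norm_exp_ofReal_mul_I]
    · simp only [Function.uncurry, a]
      ring
  have h1 (ξ : R3) : regSymbol ε t ξ * (starRingEnd ℂ (𝓕 (f : R3 → ℂ) ξ) * 𝓕 (g : R3 → ℂ) ξ) =
      ∫ v, a v ξ ∂(volume.prod volume) := by
    rw [Real.fourier_eq', Real.fourier_eq', ← integral_conj, ← integral_prod_mul,
      ← integral_const_mul]
    refine integral_congr_ae (.of_forall fun v => ?_)
    simp only [a, smul_eq_mul, map_mul, ← Complex.exp_conj]
    have e : Complex.exp (2 * Real.pi * Complex.I * (inner ℝ (v.1 - v.2) ξ : ℝ)) =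
        Complex.exp (starRingEnd ℂ (((-2 * Real.pi * inner ℝ v.1 ξ : ℝ) : ℂ) * Complex.I)) *
        Complex.exp (((-2 * Real.pi * inner ℝ v.2 ξ : ℝ) : ℂ) * Complex.I) := by
      rw [← Complex.exp_add, inner_sub_left, map_mul, Complex.conj_ofReal, Complex.conj_I]
      congr 1
      push_cast
      ring
    simp only [map_mul] at e
    rw [e]
    ring
  simp_rw [h1]
  rw [← integral_integral_swap ha]
  have h2 (v : R3 × R3) : ∫ ξ, a v ξ = starRingEnd ℂ (f v.1) * g v.2 * regKernel ε t (v.1 - v.2) := by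
    simp only [a]
    rw [integral_const_mul, regKernel]
  simp_rw [h2]
  refine (enorm_integral_le_lintegral_enorm _).trans_eq ?_
  have hm := continuous_regKernel hε t
  rw [lintegral_prod _ (by fun_prop)]
  refine lintegral_congr fun x => lintegral_congr fun y => ?_
  simp only [enorm_mul, RCLike.enorm_conj]
  ring

lemma measurable_L2 (f : L2) : Measurable f := (Lp.stronglyMeasurable f).measurable

lemma absForm_le {ε : ℝ} (hε : 0 < ε) (t : ℝ) (f g : L2) :
    absForm ε t f g ≤ (∫⁻ v, ‖regKernel ε t v‖ₑ) * (‖f‖ₑ * ‖g‖ₑ) := by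
  have := measurable_L2 f
  have := measurable_L2 g
  have hk : Measurable (regKernel ε t) := (continuous_regKernel hε t).measurable
  rw [enorm_L2_eq, enorm_L2_eq]
  exact lintegral_convolution_le volume (f := fun x => ‖f x‖ₑ) (k := fun x => ‖regKernel ε t x‖ₑ)
    (g := fun x => ‖g x‖ₑ) (by fun_prop) (by fun_prop) (by fun_prop)

lemma absForm_mono_add {ε : ℝ} (hε : 0 < ε) (t : ℝ) {f g f₁ g₁ f₂ g₂ f₃ g₃ : R3 → ℂ}
    (hf₁ : Measurable f₁) (hg₁ : Measurable g₁) (hf₂ : Measurable f₂) (hg₂ : Measurable g₂)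
    (h : ∀ᵐ x, ∀ᵐ y, ‖f x‖ₑ * ‖g y‖ₑ ≤ ‖f₁ x‖ₑ * ‖g₁ y‖ₑ + ‖f₂ x‖ₑ * ‖g₂ y‖ₑ + ‖f₃ x‖ₑ * ‖g₃ y‖ₑ) :
    absForm ε t f g ≤ absForm ε t f₁ g₁ + absForm ε t f₂ g₂ + absForm ε t f₃ g₃ := by
  have hk : Measurable (regKernel ε t) := (continuous_regKernel hε t).measurable
  unfold absForm
  rw [← lintegral_add_left, ← lintegral_add_left]
  · apply lintegral_mono_ae
    filter_upwards [h] with x hx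
    rw [← lintegral_add_left (by fun_prop), ← lintegral_add_left (by fun_prop)]
    apply lintegral_mono_ae
    filter_upwards [hx] with y hy
    calc ‖f x‖ₑ * ‖regKernel ε t (x - y)‖ₑ * ‖g y‖ₑ
        = ‖regKernel ε t (x - y)‖ₑ * (‖f x‖ₑ * ‖g y‖ₑ) := by ring
      _ ≤ ‖regKernel ε t (x - y)‖ₑ *
          (‖f₁ x‖ₑ * ‖g₁ y‖ₑ + ‖f₂ x‖ₑ * ‖g₂ y‖ₑ + ‖f₃ x‖ₑ * ‖g₃ y‖ₑ) := by gcongr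
      _ = _ := by ring
  · exact Measurable.add (Measurable.lintegral_prod_right' (f := fun v : R3 × R3 =>
      ‖f₁ v.1‖ₑ * ‖regKernel ε t (v.1 - v.2)‖ₑ * ‖g₁ v.2‖ₑ) (by fun_prop))
      (Measurable.lintegral_prod_right' (f := fun v : R3 × R3 =>
      ‖f₂ v.1‖ₑ * ‖regKernel ε t (v.1 - v.2)‖ₑ * ‖g₂ v.2‖ₑ) (by fun_prop))
  · exact Measurable.lintegral_prod_right' (f := fun v : R3 × R3 =>
      ‖f₁ v.1‖ₑ * ‖regKernel ε t (v.1 - v.2)‖ₑ * ‖g₁ v.2‖ₑ) (by fun_prop)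

lemma enorm_regForm_le {ε : ℝ} (hε : 0 < ε) (t : ℝ) (f g : L2) :
    ‖regForm ε t f g‖ₑ ≤ absForm ε t f g := by
  set κ := ∫⁻ v, ‖regKernel ε t v‖ₑ with hκ
  have hκt : κ ≠ ∞ := (integrable_regKernel hε t).hasFiniteIntegral.ne
  -- The bound is extended from Schwartz pairs with an error that vanishes at v = (f, g). As f and g
  -- stay fixed in `absForm`, the condition is closed in v. For Schwartz φ, ψ it follows from φψ =
  -- fg + (φ - f)g + φ(ψ - g) and Schur's test on the last two terms.
  have key : ∀ v : L2 × L2, ‖regForm ε t v.1 v.2‖ₑ ≤ absForm ε t f g +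
      ENNReal.ofReal (κ.toReal * (‖v.1 - f‖ * ‖g‖ + ‖v.1‖ * ‖v.2 - g‖)) := by
    have hd : DenseRange (Prod.map (fun φ : 𝓢(R3, ℂ) => (φ.toLp 2 : L2))
        (fun φ : 𝓢(R3, ℂ) => (φ.toLp 2 : L2))) := by
      have h := SchwartzMap.denseRange_toLpCLM (E := R3) (F := ℂ) (p := 2) (μ := volume)
        ENNReal.ofNat_ne_top
      exact DenseRange.prodMap h h
    intro v
    refine hd.induction_on (p := fun v : L2 × L2 => ‖regForm ε t v.1 v.2‖ₑ ≤ absForm ε t f g +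
      ENNReal.ofReal (κ.toReal * (‖v.1 - f‖ * ‖g‖ + ‖v.1‖ * ‖v.2 - g‖))) v ?_ ?_
    · have := continuous_regForm hε t
      refine isClosed_le (by fun_prop) ?_
      refine continuous_const.add (ENNReal.continuous_ofReal.comp ?_)
      fun_prop
    · rintro ⟨φ, ψ⟩
      simp only [Prod.map]
      set φ' : L2 := φ.toLp 2 with hφ'
      set ψ' : L2 := ψ.toLp 2 with hψ'
      have e1 : regForm ε t φ' ψ' = ∫ ξ, regSymbol ε t ξ *
          (starRingEnd ℂ (𝓕 (φ : R3 → ℂ) ξ) * 𝓕 (ψ : R3 → ℂ) ξ) := by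
        rw [regForm, hφ', hψ', SchwartzMap.toLp_fourier_eq, SchwartzMap.toLp_fourier_eq]
        apply integral_congr_ae
        filter_upwards [SchwartzMap.coeFn_toLp (𝓕 φ) 2 (volume : Measure R3),
          SchwartzMap.coeFn_toLp (𝓕 ψ) 2 (volume : Measure R3)] with ξ h1 h2
        rw [h1, h2, SchwartzMap.fourier_coe, SchwartzMap.fourier_coe]
      have e2 : absForm ε t φ ψ = absForm ε t φ' ψ' :=
        absForm_congr_ae (SchwartzMap.coeFn_toLp φ 2 (volume : Measure R3)).symm
          (SchwartzMap.coeFn_toLp ψ 2 (volume : Measure R3)).symm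
      rw [e1]
      refine (enorm_integral_schwartz_le hε t φ ψ).trans ?_
      rw [e2]
      calc absForm ε t φ' ψ' ≤ absForm ε t f g + absForm ε t (φ' - f : L2) g +
            absForm ε t φ' (ψ' - g : L2) := by
            refine absForm_mono_add hε t (measurable_L2 _) (measurable_L2 _) (measurable_L2 _)
              (measurable_L2 _) ?_
            filter_upwards [Lp.coeFn_sub φ' f] with x hx
            filter_upwards [Lp.coeFn_sub ψ' g] with y hy
            rw [hx, hy, Pi.sub_apply, Pi.sub_apply]
            calc ‖φ' x‖ₑ * ‖ψ' y‖ₑ ≤ ‖φ' x‖ₑ * (‖g y‖ₑ + ‖ψ' y - g y‖ₑ) := by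
                  gcongr
                  calc ‖ψ' y‖ₑ = ‖g y + (ψ' y - g y)‖ₑ := by congr 1; ring
                    _ ≤ _ := enorm_add_le _ _
              _ = ‖φ' x‖ₑ * ‖g y‖ₑ + ‖φ' x‖ₑ * ‖ψ' y - g y‖ₑ := mul_add _ _ _
              _ ≤ (‖f x‖ₑ + ‖φ' x - f x‖ₑ) * ‖g y‖ₑ + ‖φ' x‖ₑ * ‖ψ' y - g y‖ₑ := by
                  gcongr
                  calc ‖φ' x‖ₑ = ‖f x + (φ' x - f x)‖ₑ := by congr 1; ring
                    _ ≤ _ := enorm_add_le _ _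
              _ = _ := by rw [add_mul]
        _ ≤ absForm ε t f g + κ * (‖φ' - f‖ₑ * ‖g‖ₑ) + κ * (‖φ'‖ₑ * ‖ψ' - g‖ₑ) := by
            gcongr <;> exact absForm_le hε t _ _
        _ = _ := by
            rw [ENNReal.ofReal_mul ENNReal.toReal_nonneg, ENNReal.ofReal_toReal hκt,
              ENNReal.ofReal_add (by positivity) (by positivity), ENNReal.ofReal_mul (norm_nonneg _),
              ENNReal.ofReal_mul (norm_nonneg _)]
            simp only [ofReal_norm]
            ring
  simpa using key (f, g)

lemma lintegral_lintegral_splitEquiv {a : R3 → R3 → ℝ≥0∞} (ha : Measurable (Function.uncurry a)) :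
    ∫⁻ x, ∫⁻ y, a x y =
      ∫⁻ w, ∫⁻ w', ∫⁻ z, ∫⁻ z', a (splitEquiv (w, z)) (splitEquiv (w', z')) := by
  rw [← lintegral_splitEquiv (fun x => ∫⁻ y, a x y) ha.lintegral_prod_right']
  refine lintegral_congr fun w => ?_
  have h (z : ℝ) : ∫⁻ y, a (splitEquiv (w, z)) y =
      ∫⁻ w', ∫⁻ z', a (splitEquiv (w, z)) (splitEquiv (w', z')) :=
    (lintegral_splitEquiv (a (splitEquiv (w, z))) (ha.comp measurable_prodMk_left)).symm
  simp_rw [h]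
  rw [lintegral_lintegral_swap]
  have hs : Measurable fun v : (ℝ × (ℝ × ℝ)) × ℝ =>
      (splitEquiv (w, v.1.1), splitEquiv (v.1.2, v.2)) := by fun_prop
  exact (ha.comp hs).lintegral_prod_right'.aemeasurable

/-- The bound of the kernel depends on z - z' alone. The (x, y) integrals therefore decouple into L¹
norms, while Schur's test with a kernel of mass 1 gives the L²_z norms. -/
lemma absForm_le_spaceNorm {ε : ℝ} (hε : 0 < ε) {t : ℝ} (ht : t ≠ 0) (f g : L2) :
    absForm ε t f g ≤ rieszKernel 1 t * (spaceNorm 1 f * spaceNorm 1 g) := by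
  have hf := measurable_L2 f
  have hg := measurable_L2 g
  have hz := measurable_zKernel ε t
  let a : R3 → R3 → ℝ≥0∞ := fun x y => ‖f x‖ₑ * zKernel ε t (x 2 - y 2) * ‖g y‖ₑ
  have ha : Measurable (Function.uncurry a) := by
    unfold a Function.uncurry
    fun_prop
  have hr : rieszKernel 1 t ≠ ∞ := by simp [rieszKernel, ht]
  have n1 (h : R3 → ℂ) : spaceNorm 1 h = ∫⁻ w, zNorm h w := by
    have := spaceNorm_eq_lintegral (p := 1) one_pos h
    simpa using this
  have mz : Measurable (zNorm f) := measurable_zNorm hf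
  have mz' : Measurable (zNorm g) := measurable_zNorm hg
  calc absForm ε t f g ≤ ∫⁻ x, ∫⁻ y, rieszKernel 1 t * a x y := by
        refine lintegral_mono fun x => lintegral_mono fun y => ?_
        calc _ ≤ ‖f x‖ₑ * (rieszKernel 1 t * zKernel ε t ((x - y) 2)) * ‖g y‖ₑ := by
              gcongr
              exact enorm_regKernel_le hε ht _
          _ = _ := by simp only [a, PiLp.sub_apply]; ring
    _ = rieszKernel 1 t * ∫⁻ x, ∫⁻ y, a x y := by
        rw [← lintegral_const_mul' _ _ hr]
        refine lintegral_congr fun x => ?_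
        rw [lintegral_const_mul' _ _ hr]
    _ = rieszKernel 1 t * ∫⁻ w, ∫⁻ w', ∫⁻ z, ∫⁻ z', a (splitEquiv (w, z)) (splitEquiv (w', z')) := by
        rw [lintegral_lintegral_splitEquiv ha]
    _ ≤ rieszKernel 1 t * ∫⁻ w, ∫⁻ w', zNorm f w * zNorm g w' := by
        gcongr with w w'
        rw [zNorm_eq, zNorm_eq]
        have := lintegral_convolution_le (volume : Measure ℝ)
          (f := fun z => ‖f (splitEquiv (w, z))‖ₑ) (k := zKernel ε t)
          (g := fun z => ‖g (splitEquiv (w', z))‖ₑ) (by fun_prop) hz (by fun_prop)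
        rw [lintegral_zKernel hε, one_mul] at this
        exact this
    _ = _ := by
        rw [n1, n1]
        congr 1
        rw [← lintegral_mul_const _ mz]
        exact lintegral_congr fun w => lintegral_const_mul _ mz'

/-- The dispersive estimate. -/
theorem enorm_inner_U_le {t : ℝ} (ht : t ≠ 0) (f g : L2) :
    ‖inner ℂ f (U t g)‖ₑ ≤ rieszKernel 1 t * (spaceNorm 1 f * spaceNorm 1 g) := by
  -- The damping is removed by dominated convergence, the damped symbols being bounded by 1.
  have hlim : Filter.Tendsto (fun ε => regForm ε t f g) (nhdsWithin 0 (Set.Ioi 0))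
      (nhds (inner ℂ f (U t g))) := by
    rw [inner_U]
    refine tendsto_integral_filter_of_dominated_convergence
      (fun ξ => ‖starRingEnd ℂ ((𝓕 f : L2) ξ) * (𝓕 g : L2) ξ‖)
      (.of_forall fun ε => (continuous_regSymbol ε t).aestronglyMeasurable.mul
        (integrable_fourier_mul f g).aestronglyMeasurable)
      ?_ (integrable_fourier_mul f g).norm (.of_forall fun ξ => ?_)
    · filter_upwards [self_mem_nhdsWithin] with ε hε
      refine .of_forall fun ξ => ?_
      rw [norm_mul]
      exact mul_le_of_le_one_left (norm_nonneg _) (norm_regSymbol_le (le_of_lt hε) t ξ)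
    · have hc : Continuous fun ε => regSymbol ε t ξ * (starRingEnd ℂ ((𝓕 f : L2) ξ) * (𝓕 g : L2) ξ) := by
        unfold regSymbol
        fun_prop
      have := hc.tendsto 0
      simp only [regSymbol, zero_mul, neg_zero, Real.exp_zero, Complex.ofReal_one, one_mul] at this
      exact this.mono_left nhdsWithin_le_nhds
  refine le_of_tendsto hlim.enorm ?_
  filter_upwards [self_mem_nhdsWithin] with ε hε
  exact (enorm_regForm_le hε t f g).trans (absForm_le_spaceNorm hε ht f g)

/-! ### Interpolation through dyadic levels -/

/-- The coordinates `(x, y)`. -/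
def xy (x : R3) : ℝ × ℝ := (x 0, x 1)

lemma measurable_xy : Measurable xy := by unfold xy; fun_prop

@[simp] lemma xy_splitEquiv (w : ℝ × ℝ) (z : ℝ) : xy (splitEquiv (w, z)) = w := by
  simp [xy, splitEquiv_apply]

lemma zNorm_mul (m : ℝ × ℝ → ℂ) (f : R3 → ℂ) (w : ℝ × ℝ) :
    zNorm (fun x => m (xy x) * f x) w = ‖m w‖ₑ * zNorm f w := by
  simp only [zNorm, xy_splitEquiv]
  exact eLpNorm_const_smul (m w) _ _ _

/-- The dyadic level of the `L²_z` norm. -/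
def level (f : R3 → ℂ) (w : ℝ × ℝ) : ℤ := ⌊Real.logb 2 (zNorm f w).toReal⌋

lemma measurable_level {f : R3 → ℂ} (hf : Measurable f) : Measurable (level f) := by
  have := measurable_zNorm hf
  unfold level
  simp only [Real.logb]
  fun_prop

lemma measurableSet_level (f : L2) (k : ℤ) : MeasurableSet {x : R3 | level f (xy x) = k} :=
  ((measurable_level (measurable_L2 f)).comp measurable_xy) (measurableSet_singleton k)

/-- The part of `f` at which its `L²_z` norm has level `k`. -/
def piece (f : L2) (k : ℤ) : L2 := ((Lp.memLp f).indicator (measurableSet_level f k)).toLp _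

lemma piece_coeFn (f : L2) (k : ℤ) :
    piece f k =ᵐ[volume] fun x => if level f (xy x) = k then f x else 0 :=
  (MemLp.coeFn_toLp _).trans (.of_forall fun x => by
    simp only [Set.indicator_apply, Set.mem_ofPred_eq])

/-- Finite linear combinations of the level pieces of `f`. -/
def combine (f : L2) (S : Finset ℤ) (c : ℤ → ℂ) : L2 := ∑ k ∈ S, c k • piece f k

lemma combine_coeFn (f : L2) (S : Finset ℤ) (c : ℤ → ℂ) :
    combine f S c =ᵐ[volume] fun x =>
      (if level f (xy x) ∈ S then c (level f (xy x)) else 0) * f x := by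
  classical
  unfold combine
  induction S using Finset.induction_on with
  | empty =>
    simp only [Finset.sum_empty, Finset.notMem_empty, if_false, zero_mul]
    exact Lp.coeFn_zero _ _ _
  | insert k S hk ih =>
    rw [Finset.sum_insert hk]
    filter_upwards [ih, Lp.coeFn_add (c k • piece f k) (∑ k ∈ S, c k • piece f k),
      Lp.coeFn_smul (c k) (piece f k), piece_coeFn f k] with x h1 h2 h3 h4
    rw [h2, Pi.add_apply, h1, h3, Pi.smul_apply, h4]
    by_cases hx : level f (xy x) = k
    · simp [hx, hk]
    · simp [hx]

lemma zNorm_combine (f : L2) (S : Finset ℤ) (c : ℤ → ℂ) :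
    ∀ᵐ w, zNorm (combine f S c) w ≤ ‖c (level f w)‖ₑ * zNorm f w := by
  filter_upwards [zNorm_congr_ae (combine_coeFn f S c)] with w hw
  rw [hw, zNorm_mul (fun w => if level f w ∈ S then c (level f w) else 0)]
  gcongr
  split_ifs <;> simp

/-- With N the norm and L = 2^level one has L ≤ N ≤ 2L, so L^(s-1) and N^(s-1) are comparable. For s
≥ 1 no constant is lost; for s < 1 the loss is 2^(1-s), at most 2 since s ≥ 0. -/
lemma rpow_level_mul_le (f : R3 → ℂ) (w : ℝ × ℝ) (h : zNorm f w ≠ ∞) {s : ℝ} (hs : 0 ≤ s) :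
    ENNReal.ofReal ((2 : ℝ) ^ ((level f w : ℝ) * (s - 1))) * zNorm f w ≤ 2 * zNorm f w ^ s := by
  by_cases h0 : zNorm f w = 0
  · simp [h0]
  set N := (zNorm f w).toReal with hN
  have hNpos : 0 < N := ENNReal.toReal_pos h0 h
  have e : zNorm f w = ENNReal.ofReal N := (ENNReal.ofReal_toReal h).symm
  rw [e, ENNReal.ofReal_rpow_of_pos hNpos, ← ENNReal.ofReal_mul (by positivity),
    ← ENNReal.ofReal_ofNat 2, ← ENNReal.ofReal_mul (by norm_num)]
  refine ENNReal.ofReal_le_ofReal ?_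
  have hl : (2 : ℝ) ^ (level f w : ℝ) ≤ N := by
    rw [← Real.le_logb_iff_rpow_le (by norm_num) hNpos]
    exact Int.floor_le _
  have hu : N ≤ 2 * (2 : ℝ) ^ (level f w : ℝ) := by
    have : N ≤ (2 : ℝ) ^ ((level f w : ℝ) + 1) := by
      rw [← Real.logb_le_iff_le_rpow (by norm_num) hNpos]
      exact (Int.lt_floor_add_one _).le
    rwa [Real.rpow_add (by norm_num), Real.rpow_one, mul_comm] at this
  set L := (2 : ℝ) ^ (level f w : ℝ) with hL
  have hLpos : 0 < L := by positivity
  rw [Real.rpow_mul (by norm_num), ← hL]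
  have hNs : N ^ s = N ^ (s - 1) * N := by
    rw [← Real.rpow_add_one hNpos.ne']; congr 1; ring
  rw [hNs, ← mul_assoc]
  refine mul_le_mul_of_nonneg_right ?_ hNpos.le
  rcases le_total 1 s with h1 | h1
  · calc L ^ (s - 1) ≤ N ^ (s - 1) := Real.rpow_le_rpow hLpos.le hl (by linarith)
      _ ≤ 2 * N ^ (s - 1) := by linarith [Real.rpow_nonneg hNpos.le (s - 1)]
  · calc L ^ (s - 1) ≤ (N / 2) ^ (s - 1) :=
          Real.rpow_le_rpow_of_nonpos (by positivity) (by linarith) (by linarith)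
      _ = N ^ (s - 1) * 2 ^ (1 - s) := by
          rw [Real.div_rpow hNpos.le (by norm_num), div_eq_mul_inv, ← Real.rpow_neg (by norm_num)]
          congr 2; ring
      _ ≤ N ^ (s - 1) * 2 ^ (1 : ℝ) := by
          gcongr
          · norm_num
          · linarith
      _ = _ := by rw [Real.rpow_one]; ring

lemma enorm_L2_eq_zNorm (f : L2) : ‖f‖ₑ = (∫⁻ w, zNorm f w ^ (2 : ℝ)) ^ (1 / 2 : ℝ) := by
  have := spaceNorm_eq_lintegral (p := 2) (by norm_num) f
  rw [ENNReal.ofReal_ofNat, spaceNorm_two (Lp.aestronglyMeasurable f)] at this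
  rw [Lp.enorm_def, this]

lemma ae_zNorm_ne_top (f : L2) : ∀ᵐ w, zNorm f w ≠ ∞ := by
  have h : ∫⁻ w, zNorm f w ^ (2 : ℝ) ≠ ∞ := by
    intro h
    have := enorm_L2_eq_zNorm f
    rw [h] at this
    simp at this
  have := ae_lt_top ((measurable_zNorm (measurable_L2 f)).pow_const _) h
  filter_upwards [this] with w hw h
  simp [h] at hw

/-- The coefficient of level `k` in the analytic family through `f`. -/
def coeff (r : ℝ) (ζ : ℂ) (k : ℤ) : ℂ :=
  Complex.exp ((k * Real.log 2 : ℝ) * (r * (1 - ζ / 2) - 1))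

lemma norm_coeff (r : ℝ) (ζ : ℂ) (k : ℤ) :
    ‖coeff r ζ k‖ = (2 : ℝ) ^ ((k : ℝ) * (r * (1 - ζ.re / 2) - 1)) := by
  rw [coeff, Complex.norm_exp, Complex.re_ofReal_mul, Real.rpow_def_of_pos (by norm_num)]
  congr 1
  simp
  ring

/-- Multiplying level k by a number of modulus 2^(k(σ-1)), where σ = r(1 - Re ζ/2), replaces the
norm N by at most 2N^σ. Only the moduli of the coefficients are prescribed, so that the result
serves ζ and its conjugate alike. -/
lemma lintegral_zNorm_combine_le (f : L2) (S : Finset ℤ) {r : ℝ} (hr : 0 ≤ r)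
    {c : ℤ → ℂ} {ζ : ℂ} (hζ : ζ.re ≤ 1) (hc : ∀ k, ‖c k‖ = ‖coeff r ζ k‖)
    {s : ℝ} (hs : 0 ≤ s) :
    ∫⁻ w, zNorm (combine f S c) w ^ s ≤
      2 ^ s * ∫⁻ w, zNorm f w ^ (r * (1 - ζ.re / 2) * s) := by
  rw [← lintegral_const_mul' _ _ (by simp)]
  apply lintegral_mono_ae
  filter_upwards [zNorm_combine f S c, ae_zNorm_ne_top f] with w h3 h4
  rw [ENNReal.rpow_mul, ← ENNReal.mul_rpow_of_nonneg _ _ hs]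
  refine ENNReal.rpow_le_rpow (h3.trans ?_) hs
  rw [← ofReal_norm, hc, norm_coeff]
  exact rpow_level_mul_le f w h4 (mul_nonneg hr (by linarith))

/-- The inner product is conjugate-linear in its first slot; evaluating that family at the conjugate
of ζ restores holomorphy. -/
lemma conj_coeff (r : ℝ) (ζ : ℂ) (k : ℤ) :
    starRingEnd ℂ (coeff r (starRingEnd ℂ ζ) k) = coeff r ζ k := by
  rw [coeff, coeff, ← Complex.exp_conj, map_mul, Complex.conj_ofReal]
  congr 2
  simp [map_ofNat]

lemma differentiable_coeff (r : ℝ) (k : ℤ) : Differentiable ℂ fun ζ => coeff r ζ k := by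
  unfold coeff
  fun_prop

lemma norm_coeff_le (r : ℝ) (hr : 0 ≤ r) {ζ : ℂ} (h1 : 0 ≤ ζ.re) (h2 : ζ.re ≤ 1) (k : ℤ) :
    ‖coeff r ζ k‖ ≤ (2 : ℝ) ^ (|(k : ℝ)| * (r + 1)) := by
  rw [norm_coeff]
  refine Real.rpow_le_rpow_of_exponent_le (by norm_num) ((le_abs_self _).trans ?_)
  rw [abs_mul]
  gcongr
  rw [abs_le]
  constructor <;> nlinarith

lemma tendsto_combine_one (f : L2) :
    Filter.Tendsto (fun n : ℕ => combine f (Finset.Icc (-n : ℤ) n) fun _ => 1) Filter.atTop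
      (nhds f) := by
  rw [Lp.tendsto_Lp_iff_tendsto_eLpNorm']
  have hm := measurable_L2 f
  have h1 (n : ℕ) : eLpNorm (⇑(combine f (Finset.Icc (-n : ℤ) n) fun _ => 1) - ⇑f) 2 volume =
      (∫⁻ x, (if level f (xy x) ∈ Finset.Icc (-n : ℤ) n then 0 else ‖f x‖ₑ ^ (2 : ℝ))) ^
        (1 / 2 : ℝ) := by
    rw [eLpNorm_eq_lintegral_rpow_enorm_toReal (by norm_num) (by norm_num)]
    simp only [ENNReal.toReal_ofNat]
    congr 1
    apply lintegral_congr_ae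
    filter_upwards [combine_coeFn f (Finset.Icc (-n : ℤ) n) fun _ => 1] with x hx
    rw [Pi.sub_apply, hx]
    split_ifs <;> simp
  simp_rw [h1]
  suffices h : Filter.Tendsto (fun n : ℕ => ∫⁻ x, (if level f (xy x) ∈ Finset.Icc (-n : ℤ) n then 0
      else ‖f x‖ₑ ^ (2 : ℝ))) Filter.atTop (nhds (∫⁻ _ : R3, 0)) by
    rw [lintegral_zero] at h
    have := ((ENNReal.continuous_rpow_const (y := (1 / 2 : ℝ))).tendsto 0).comp h
    rwa [ENNReal.zero_rpow_of_pos (by norm_num)] at this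
  have hfin : ∫⁻ x, ‖f x‖ₑ ^ (2 : ℝ) ≠ ∞ := by
    intro h
    have := enorm_L2_eq f
    rw [h] at this
    simp at this
  refine tendsto_lintegral_of_dominated_convergence (fun x => ‖f x‖ₑ ^ (2 : ℝ)) (fun n => ?_)
    (fun n => .of_forall fun x => ?_) hfin (.of_forall fun x => ?_)
  · refine Measurable.ite ?_ measurable_const (by fun_prop)
    exact ((measurable_level hm).comp measurable_xy) (Finset.measurableSet _)
  · simp only; split_ifs <;> simp
  · refine tendsto_const_nhds.congr' ?_
    filter_upwards [Filter.eventually_ge_atTop (level f (xy x)).natAbs] with n hn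
    rw [if_pos]
    rw [Finset.mem_Icc]
    omega

/-- Interpolation between the `L²` bound and the `L¹_{xy} L²_z` bound of a bilinear form, for
normalised functions. -/
lemma norm_inner_le_of_lintegral_le_one {T : L2 →ₗᵢ[ℂ] L2} {D : ℝ} (hD : 0 < D)
    (hT : ∀ f g : L2, ‖inner ℂ f (T g)‖ₑ ≤ ENNReal.ofReal D * (spaceNorm 1 f * spaceNorm 1 g))
    {α : ℝ} (hα0 : 0 ≤ α) (hα1 : α ≤ 1) {f g : L2}
    (hf : ∫⁻ w, zNorm f w ^ (2 / (1 + α)) ≤ 1) (hg : ∫⁻ w, zNorm g w ^ (2 / (1 + α)) ≤ 1) :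
    ‖inner ℂ f (T g)‖ ≤ 4 * D ^ α := by
  set r := 2 / (1 + α) with hr
  have hr0 : 0 < r := by positivity
  have key (S : Finset ℤ) : ‖inner ℂ (combine f S fun _ => 1) (T (combine g S fun _ => 1))‖ ≤
      4 * D ^ α := by
    -- The family behaves like N^r, measured in L¹, on Re ζ = 0 and like N^(r/2), measured in L², on
    -- Re ζ = 1; at ζ = 1 - α all coefficients are 1. Rounding N to finitely many dyadic levels
    -- makes Φ a finite sum of exponentials, hence entire and bounded on the strip, at the price of
    -- a factor 2 in each slot.
    let Φ : ℂ → ℂ := fun ζ => inner ℂ (combine f S (coeff r (starRingEnd ℂ ζ)))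
      (T (combine g S (coeff r ζ)))
    have hΦ (ζ : ℂ) : Φ ζ =
        ∑ k ∈ S, ∑ l ∈ S, coeff r ζ k * coeff r ζ l * inner ℂ (piece f l) (T (piece g k)) := by
      simp only [Φ, combine, map_sum, map_smul, sum_inner, inner_sum, inner_smul_left,
        inner_smul_right, conj_coeff, Finset.mul_sum, mul_assoc]
    have hd : Differentiable ℂ Φ := by
      rw [funext hΦ]
      refine Differentiable.fun_sum fun k _ => Differentiable.fun_sum fun l _ => ?_
      exact ((differentiable_coeff r k).mul (differentiable_coeff r l)).mul_const _
    have hB : BddAbove ((norm ∘ Φ) '' Complex.HadamardThreeLines.verticalClosedStrip 0 1) := by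
      refine ⟨∑ k ∈ S, ∑ l ∈ S, (2 : ℝ) ^ (|(k : ℝ)| * (r + 1)) * (2 : ℝ) ^ (|(l : ℝ)| * (r + 1)) *
        ‖inner ℂ (piece f l) (T (piece g k))‖, ?_⟩
      rintro _ ⟨ζ, hζ, rfl⟩
      have hζ' : ζ.re ∈ Set.Icc (0 : ℝ) 1 := hζ
      simp only [Function.comp, hΦ]
      refine (norm_sum_le _ _).trans (Finset.sum_le_sum fun k _ =>
        (norm_sum_le _ _).trans (Finset.sum_le_sum fun l _ => ?_))
      rw [norm_mul, norm_mul]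
      gcongr
      · exact norm_coeff_le r hr0.le hζ'.1 hζ'.2 k
      · exact norm_coeff_le r hr0.le hζ'.1 hζ'.2 l
    have n1 (h : R3 → ℂ) : spaceNorm 1 h = ∫⁻ w, zNorm h w ^ (1 : ℝ) := by
      have := spaceNorm_eq_lintegral (p := 1) one_pos h
      simpa using this
    have hc (ζ : ℂ) (k : ℤ) : ‖coeff r (starRingEnd ℂ ζ) k‖ = ‖coeff r ζ k‖ := by
      simp [norm_coeff]
    have ha : ∀ ζ ∈ Complex.re ⁻¹' {0}, ‖Φ ζ‖ ≤ 4 * D := by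
      intro ζ hζ
      have hζ' : ζ.re = 0 := hζ
      have b (h : L2) (hh : ∫⁻ w, zNorm h w ^ r ≤ 1) (c : ℤ → ℂ)
          (hc : ∀ k, ‖c k‖ = ‖coeff r ζ k‖) : spaceNorm 1 (combine h S c) ≤ 2 := by
        rw [n1]
        refine (lintegral_zNorm_combine_le h S hr0.le (by simp [hζ']) hc zero_le_one).trans ?_
        rw [hζ']
        norm_num
        exact mul_le_of_le_one_right' hh
      have := (hT (combine f S (coeff r (starRingEnd ℂ ζ))) (combine g S (coeff r ζ))).trans
        (mul_le_mul_right (mul_le_mul' (b f hf _ (hc ζ)) (b g hg _ fun _ => rfl)) _)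
      rw [← ofReal_norm] at this
      refine (ENNReal.ofReal_le_ofReal_iff (by positivity)).1 (this.trans_eq ?_)
      rw [ENNReal.ofReal_mul (by norm_num), mul_comm]
      norm_num
    have hb : ∀ ζ ∈ Complex.re ⁻¹' {1}, ‖Φ ζ‖ ≤ 4 := by
      intro ζ hζ
      have hζ' : ζ.re = 1 := hζ
      have b (h : L2) (hh : ∫⁻ w, zNorm h w ^ r ≤ 1) (c : ℤ → ℂ)
          (hc : ∀ k, ‖c k‖ = ‖coeff r ζ k‖) : ‖combine h S c‖ ≤ 2 := by
        have : ‖combine h S c‖ₑ ≤ 2 := by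
          rw [enorm_L2_eq_zNorm]
          calc _ ≤ ((2 : ℝ≥0∞) ^ (2 : ℝ) * 1) ^ (1 / 2 : ℝ) := by
                refine ENNReal.rpow_le_rpow ?_ (by norm_num)
                refine (lintegral_zNorm_combine_le h S hr0.le (by simp [hζ']) hc zero_le_two).trans ?_
                rw [hζ', show r * (1 - 1 / 2) * 2 = r by ring]
                exact mul_le_mul_right hh _
            _ = 2 := by rw [mul_one, ← ENNReal.rpow_mul]; norm_num
        rw [← ofReal_norm] at this
        exact (ENNReal.ofReal_le_ofReal_iff (by norm_num)).1 (this.trans_eq (by simp))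
      refine (norm_inner_le_norm _ _).trans ?_
      rw [T.norm_map]
      have h1 := b f hf _ (hc ζ)
      have h2 := b g hg _ fun _ => rfl
      calc _ ≤ (2 : ℝ) * 2 := mul_le_mul h1 h2 (norm_nonneg _) (by norm_num)
        _ = 4 := by norm_num
    -- At Re ζ = 1 - α the three lines theorem gives (4D)^α · 4^(1-α) = 4 D^α.
    have main := Complex.HadamardThreeLines.norm_le_interp_of_mem_verticalClosedStrip₀₁' Φ
      (z := ((1 - α : ℝ) : ℂ)) (a := 4 * D) (b := 4)
      (show ((1 - α : ℝ) : ℂ).re ∈ Set.Icc (0 : ℝ) 1 from ⟨by simpa using hα1, by simpa using hα0⟩)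
      hd.diffContOnCl hB ha hb
    have e1 (k : ℤ) : coeff r ((1 - α : ℝ) : ℂ) k = 1 := by
      have : (r : ℂ) * (1 - ((1 - α : ℝ) : ℂ) / 2) - 1 = 0 := by
        have : r * (1 - (1 - α) / 2) - 1 = 0 := by rw [hr]; field_simp; ring
        exact_mod_cast this
      rw [coeff, this, mul_zero, Complex.exp_zero]
    have e2 : Φ ((1 - α : ℝ) : ℂ) =
        inner ℂ (combine f S fun _ => 1) (T (combine g S fun _ => 1)) := by
      simp only [Φ, Complex.conj_ofReal]
      rw [funext e1]
    rw [e2, Complex.ofReal_re, Real.mul_rpow (by norm_num) hD.le] at main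
    refine main.trans_eq ?_
    rw [show 1 - (1 - α) = α by ring]
    calc (4 : ℝ) ^ α * D ^ α * 4 ^ (1 - α) = 4 ^ α * 4 ^ (1 - α) * D ^ α := by ring
      _ = _ := by rw [← Real.rpow_add (by norm_num)]; norm_num
  -- The bound for finitely many levels does not depend on their number, and the truncations
  -- converge to f and g in L².
  have hlim : Filter.Tendsto (fun n : ℕ => ‖inner ℂ (combine f (Finset.Icc (-n : ℤ) n) fun _ => 1)
      (T (combine g (Finset.Icc (-n : ℤ) n) fun _ => 1))‖) Filter.atTop
      (nhds ‖inner ℂ f (T g)‖) :=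
    ((tendsto_combine_one f).inner ((T.continuous.tendsto _).comp (tendsto_combine_one g))).norm
  exact le_of_tendsto' hlim fun n => key _

lemma zNorm_smul (c : ℂ) (f : L2) : zNorm (c • f : L2) =ᵐ[volume] fun w => ‖c‖ₑ * zNorm f w := by
  filter_upwards [zNorm_congr_ae (Lp.coeFn_smul c f)] with w hw
  rw [hw]
  exact zNorm_mul (fun _ => c) f w

/-- The interpolated dispersive estimate. -/
theorem enorm_inner_U_le_rpow {α : ℝ} (hα0 : 0 ≤ α) (hα1 : α ≤ 1) {t : ℝ} (ht : t ≠ 0) (f g : L2) :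
    ‖inner ℂ f (U t g)‖ₑ ≤ 4 * rieszKernel α t *
      (spaceNorm (ENNReal.ofReal (2 / (1 + α))) f * spaceNorm (ENNReal.ofReal (2 / (1 + α))) g) := by
  have hr0 : 0 < 2 / (1 + α) := by positivity
  set r := 2 / (1 + α)
  have hat : 0 < |t| := abs_pos.2 ht
  have hk0 : rieszKernel α t ≠ 0 := by
    rw [rieszKernel, ENNReal.ofReal_rpow_of_pos hat, ne_eq, ENNReal.ofReal_eq_zero, not_le]
    positivity
  -- The normalisation by homogeneity requires norms in (0, ∞). A function of norm zero vanishes; if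
  -- a norm is infinite and the other nonzero, the right side is infinite because the kernel does
  -- not vanish.
  have zero (h : L2) (hh : spaceNorm (ENNReal.ofReal r) h = 0) : h = 0 := by
    rw [spaceNorm_eq_lintegral hr0, ENNReal.rpow_eq_zero_iff_of_pos (by positivity),
      lintegral_eq_zero_iff ((measurable_zNorm (measurable_L2 h)).pow_const _)] at hh
    have : ∫⁻ w, zNorm h w ^ (2 : ℝ) = 0 := by
      rw [lintegral_eq_zero_iff ((measurable_zNorm (measurable_L2 h)).pow_const _)]
      filter_upwards [hh] with w hw
      have hw' : zNorm h w ^ r = 0 := hw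
      rw [ENNReal.rpow_eq_zero_iff_of_pos hr0] at hw'
      simp [hw']
    have := (enorm_L2_eq_zNorm h).trans (by rw [this, ENNReal.zero_rpow_of_pos (by norm_num)])
    simpa using this
  by_cases hf0 : spaceNorm (ENNReal.ofReal r) f = 0
  · simp [zero f hf0]
  by_cases hg0 : spaceNorm (ENNReal.ofReal r) g = 0
  · have : U t g = 0 := by rw [zero g hg0]; exact (UL t).map_zero
    simp [this]
  by_cases hf : spaceNorm (ENNReal.ofReal r) f = ∞
  · rw [hf, ENNReal.top_mul hg0, ENNReal.mul_top (by simp [hk0])]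
    exact le_top
  by_cases hg : spaceNorm (ENNReal.ofReal r) g = ∞
  · rw [hg, ENNReal.mul_top hf0, ENNReal.mul_top (by simp [hk0])]
    exact le_top
  have norma (h : L2) (h0 : spaceNorm (ENNReal.ofReal r) h ≠ 0)
      (ht : spaceNorm (ENNReal.ofReal r) h ≠ ∞) :
      ∫⁻ w, zNorm (((spaceNorm (ENNReal.ofReal r) h).toReal⁻¹ : ℂ) • h : L2) w ^ r ≤ 1 := by
    have hs (c : ℂ) : ∫⁻ w, zNorm (c • h : L2) w ^ r = ∫⁻ w, (‖c‖ₑ * zNorm h w) ^ r := by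
      apply lintegral_congr_ae
      filter_upwards [zNorm_smul c h] with w hw
      rw [hw]
    rw [hs]
    set M := spaceNorm (ENNReal.ofReal r) h with hM
    have e : ‖((M.toReal⁻¹ : ℝ) : ℂ)‖ₑ = M⁻¹ := by
      rw [← ofReal_norm, Complex.norm_real, Real.norm_of_nonneg (by positivity),
        ENNReal.ofReal_inv_of_pos (ENNReal.toReal_pos h0 ht), ENNReal.ofReal_toReal ht]
    rw [← Complex.ofReal_inv, e]
    simp_rw [ENNReal.mul_rpow_of_nonneg _ _ hr0.le]
    rw [lintegral_const_mul' _ _ (by simp [ENNReal.rpow_eq_top_iff, h0, hr0.le]),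
      ENNReal.inv_rpow]
    have : M ^ r = ∫⁻ w, zNorm h w ^ r := by
      rw [hM, spaceNorm_eq_lintegral hr0, ← ENNReal.rpow_mul, one_div_mul_cancel hr0.ne',
        ENNReal.rpow_one]
    rw [← this]
    exact ENNReal.inv_mul_le_one _
  set A := spaceNorm (ENNReal.ofReal r) f
  set B := spaceNorm (ENNReal.ofReal r) g
  have hA := ENNReal.toReal_pos hf0 hf
  have hB := ENNReal.toReal_pos hg0 hg
  have main := norm_inner_le_of_lintegral_le_one (T := UL t) (D := |t|⁻¹) (by positivity)
    (fun f g => by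
      have := enorm_inner_U_le ht f g
      rwa [rieszKernel, ENNReal.rpow_neg_one, ← ENNReal.ofReal_inv_of_pos hat] at this)
    hα0 hα1 (norma f hf0 hf) (norma g hg0 hg)
  rw [map_smul, inner_smul_left, inner_smul_right, UL_apply, norm_mul, norm_mul, RCLike.norm_conj,
    norm_inv, norm_inv, Complex.norm_real, Complex.norm_real, Real.norm_of_nonneg hA.le,
    Real.norm_of_nonneg hB.le, inv_mul_le_iff₀ hA, inv_mul_le_iff₀ hB] at main
  rw [← ofReal_norm]
  refine (ENNReal.ofReal_le_ofReal main).trans_eq ?_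
  rw [ENNReal.ofReal_mul hB.le, ENNReal.ofReal_mul hA.le, ENNReal.ofReal_toReal hf,
    ENNReal.ofReal_toReal hg, ENNReal.ofReal_mul (by norm_num), rieszKernel,
    ENNReal.ofReal_rpow_of_pos hat, Real.inv_rpow hat.le, Real.rpow_neg hat.le,
    ENNReal.ofReal_ofNat]
  ring

/-! ### Measurability in space-time -/

instance secondCountableTopology_L2 : SecondCountableTopology L2 := by
  have : Fact ((2 : ℝ≥0∞) ≠ ∞) := ⟨by norm_num⟩
  infer_instance

/-- The distance to a fixed element is an integral of a jointly measurable function, so preimages of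
balls are measurable. By separability of L² the balls generate the Borel sets, and Borel
measurability is strong measurability. -/
lemma stronglyMeasurable_toLp {g : ℝ → R3 → ℂ} (hg : Measurable (Function.uncurry g))
    (hmem : ∀ t, MemLp (g t) 2 volume) : StronglyMeasurable fun t => (hmem t).toLp (g t) := by
  have hb : ∀ (f : L2) (ε : ℝ), MeasurableSet ((fun t => (hmem t).toLp (g t)) ⁻¹' Metric.ball f ε) := by
    intro f ε
    have hd : Measurable fun t => dist ((hmem t).toLp (g t)) f := by
      have (t : ℝ) : dist ((hmem t).toLp (g t)) f =
          ((∫⁻ x, ‖g t x - f x‖ₑ ^ (2 : ℝ)) ^ (1 / 2 : ℝ)).toReal := by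
        rw [Lp.dist_def]
        congr 1
        rw [eLpNorm_eq_lintegral_rpow_enorm_toReal (by norm_num) (by norm_num)]
        simp only [ENNReal.toReal_ofNat]
        congr 1
        apply lintegral_congr_ae
        filter_upwards [(hmem t).coeFn_toLp] with x hx
        rw [Pi.sub_apply, hx]
      simp_rw [this]
      have hf := measurable_L2 f
      refine (Measurable.pow_const (Measurable.lintegral_prod_right' (f := fun v : ℝ × R3 =>
        ‖g v.1 v.2 - f v.2‖ₑ ^ (2 : ℝ)) ?_) _).ennreal_toReal
      have hg' : Measurable fun v : ℝ × R3 => g v.1 v.2 := hg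
      fun_prop
    exact measurableSet_lt hd measurable_const
  have basis : TopologicalSpace.IsTopologicalBasis
      {s : Set L2 | ∃ (f : L2) (ε : ℝ), s = Metric.ball f ε} := by
    refine TopologicalSpace.isTopologicalBasis_of_isOpen_of_nhds ?_ fun f s hf hs => ?_
    · rintro _ ⟨f, ε, rfl⟩
      exact Metric.isOpen_ball
    · obtain ⟨ε, hε, h⟩ := Metric.isOpen_iff.1 hs f hf
      exact ⟨_, ⟨f, ε, rfl⟩, Metric.mem_ball_self hε, h⟩
  let _ : MeasurableSpace L2 := borel L2
  have : BorelSpace L2 := ⟨rfl⟩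
  have hm : @Measurable ℝ L2 _ (borel L2) fun t => (hmem t).toLp (g t) := by
    rw [basis.borel_eq_generateFrom]
    refine measurable_generateFrom ?_
    rintro _ ⟨f, ε, rfl⟩
    exact hb f ε
  exact Measurable.stronglyMeasurable hm

/-- Dominated convergence in the Fourier inversion formula. On Schwartz data the flow is thus an
honest function on space-time, jointly measurable, which the L² classes `U t f` are not. -/
lemma continuous_US (φ : 𝓢(R3, ℂ)) : Continuous fun v : ℝ × R3 => US v.1 φ v.2 := by
  simp_rw [US_eq, Real.fourierInv_eq']
  refine continuous_of_dominated (bound := fun ξ => ‖𝓕 (φ : R3 → ℂ) ξ‖) (fun v => ?_)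
    (fun v => .of_forall fun ξ => ?_) ?_ (.of_forall fun ξ => ?_)
  · have h1 := continuous_symbol v.1
    have h2 : Continuous (𝓕 (φ : R3 → ℂ)) := by
      rw [← SchwartzMap.fourier_coe]; exact (𝓕 φ).continuous
    fun_prop
  · rw [norm_smul, norm_mul, norm_symbol, one_mul, Complex.norm_exp_ofReal_mul_I, one_mul]
  · rw [← SchwartzMap.fourier_coe]; exact (𝓕 φ).integrable.norm
  · unfold symbol phase
    fun_prop

lemma US_ae_eq (t : ℝ) (φ : 𝓢(R3, ℂ)) : US t φ =ᵐ[volume] U t (φ.toLp 2) := by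
  rw [U_toLp]
  exact (SchwartzMap.coeFn_toLp _ 2 _).symm

lemma measurable_zNorm_uncurry {g : ℝ → R3 → ℂ} (hg : Measurable (Function.uncurry g)) :
    Measurable fun v : ℝ × (ℝ × ℝ) => zNorm (g v.1) v.2 := by
  simp_rw [zNorm_eq]
  refine Measurable.pow_const (Measurable.lintegral_prod_right' (f := fun v : (ℝ × (ℝ × ℝ)) × ℝ =>
    ‖g v.1.1 (splitEquiv (v.1.2, v.2))‖ₑ ^ (2 : ℝ)) ?_) _
  have h : Measurable fun v : (ℝ × (ℝ × ℝ)) × ℝ => g v.1.1 (splitEquiv (v.1.2, v.2)) :=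
    hg.comp (by fun_prop : Measurable fun v : (ℝ × (ℝ × ℝ)) × ℝ =>
      (v.1.1, splitEquiv (v.1.2, v.2)))
  fun_prop

lemma measurable_spaceNorm {p : ℝ} (hp : 0 < p) {g : ℝ → R3 → ℂ}
    (hg : Measurable (Function.uncurry g)) :
    Measurable fun t => spaceNorm (ENNReal.ofReal p) (g t) := by
  simp_rw [spaceNorm_eq_lintegral hp]
  exact Measurable.pow_const
    (((measurable_zNorm_uncurry hg).pow_const p).lintegral_prod_right') _

lemma mixedNorm_eq_lintegral {q : ℝ} (hq : 0 < q) (p : ℝ≥0∞) (g : ℝ → R3 → ℂ) :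
    mixedNorm (ENNReal.ofReal q) p g = (∫⁻ t, spaceNorm p (g t) ^ q) ^ (1 / q) := by
  rw [mixedNorm, eLpNorm_eq_lintegral_rpow_enorm_toReal (by simpa using hq) (by simp),
    ENNReal.toReal_ofReal hq.le]
  simp

lemma spaceNorm_mono (p : ℝ≥0∞) {f g : R3 → ℂ} (h : ∀ x, ‖f x‖ ≤ ‖g x‖) :
    spaceNorm p f ≤ spaceNorm p g := by
  refine eLpNorm_mono_enorm fun w => ?_
  simp only [enorm_eq_self]
  exact eLpNorm_mono fun z => h _

lemma mixedNorm_mono (q p : ℝ≥0∞) {f g : ℝ → R3 → ℂ} (h : ∀ t x, ‖f t x‖ ≤ ‖g t x‖) :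
    mixedNorm q p f ≤ mixedNorm q p g := by
  refine eLpNorm_mono_enorm fun t => ?_
  simp only [enorm_eq_self]
  exact spaceNorm_mono p (h t)

lemma mixedNorm_congr_ae (q p : ℝ≥0∞) {f g : ℝ → R3 → ℂ} (h : ∀ᵐ t, f t =ᵐ[volume] g t) :
    mixedNorm q p f = mixedNorm q p g := by
  refine eLpNorm_congr_ae ?_
  filter_upwards [h] with t ht
  exact spaceNorm_congr_ae p ht

/-! ### The TT* argument and the bilinear estimate -/

/-- The constant of the Strichartz estimates. -/
def strichartzConst (α : ℝ) : ℝ≥0∞ :=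
  (4 * (2 * (ENNReal.ofReal (2 / (1 - α)) + 2))) ^ (1 / 2 : ℝ)

lemma strichartzConst_ne_top (α : ℝ) : strichartzConst α ≠ ∞ := by
  unfold strichartzConst
  refine ENNReal.rpow_ne_top_of_nonneg (by norm_num) ?_
  finiteness

/-- The `TT*` argument for functions of time with values in `L²`. -/
lemma enorm_integral_U_le {α : ℝ} (hα0 : 0 ≤ α) (hα1 : α < 1) {G : ℝ → L2} (hG : Integrable G)
    (hN : Measurable fun t => spaceNorm (ENNReal.ofReal (2 / (1 + α))) (G t)) :
    ‖∫ t, U (-t) (G t)‖ₑ ≤ strichartzConst α *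
      mixedNorm (ENNReal.ofReal (2 / (2 - α))) (ENNReal.ofReal (2 / (1 + α))) fun t => G t := by
  set N : ℝ → ℝ≥0∞ := fun t => spaceNorm (ENNReal.ofReal (2 / (1 + α))) (G t) with hNdef
  have hF : Integrable fun t => U (-t) (G t) := by
    have hp : AEStronglyMeasurable (fun t => ((-t, G t) : ℝ × L2)) volume :=
      continuous_neg.aestronglyMeasurable.prodMk hG.aestronglyMeasurable
    have hm : AEStronglyMeasurable (fun t => U (-t) (G t)) volume :=
      Continuous.comp_aestronglyMeasurable (g := fun v : ℝ × L2 => U v.1 v.2)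
        (f := fun t => ((-t, G t) : ℝ × L2)) continuous_U hp
    exact hG.mono hm (.of_forall fun t => (norm_U _ _).le)
  set h := ∫ t, U (-t) (G t) with hh
  -- The inner product of h with itself is expanded in both slots. By `inner_U_U` each term becomes
  -- a matrix coefficient at time s - t, to which the interpolated dispersive estimate applies off
  -- the null diagonal.
  have e1 : ‖h‖ₑ ^ (2 : ℝ) ≤ ∫⁻ s, ∫⁻ t, ‖inner ℂ (U (-s) (G s)) (U (-t) (G t))‖ₑ := by
    have e2 : ‖h‖ₑ ^ (2 : ℝ) = ‖inner ℂ h h‖ₑ := by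
      rw [inner_self_eq_norm_sq_to_K]
      have : ‖((‖h‖ : ℝ) : ℂ)‖ₑ = ‖h‖ₑ := by
        rw [← ofReal_norm, Complex.norm_real, norm_norm, ofReal_norm]
      exact (ENNReal.rpow_ofNat _ 2).trans ((congrArg (· ^ 2) this.symm).trans (enorm_pow _ 2).symm)
    have e3 : inner ℂ h h = ∫ s, inner ℂ h (U (-s) (G s)) := by
      rw [integral_inner hF]
    rw [e2, e3]
    refine (enorm_integral_le_lintegral_enorm _).trans (lintegral_mono fun s => ?_)
    have e4 : inner ℂ h (U (-s) (G s)) = starRingEnd ℂ (∫ t, inner ℂ (U (-s) (G s)) (U (-t) (G t))) := by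
      rw [integral_inner hF, inner_conj_symm]
    rw [e4, RCLike.enorm_conj]
    exact enorm_integral_le_lintegral_enorm _
  have e5 : ∫⁻ s, ∫⁻ t, ‖inner ℂ (U (-s) (G s)) (U (-t) (G t))‖ₑ ≤
      4 * ∫⁻ s, ∫⁻ t, N s * N t * rieszKernel α (s - t) := by
    rw [← lintegral_const_mul' _ _ (by norm_num)]
    refine lintegral_mono fun s => ?_
    rw [← lintegral_const_mul' _ _ (by norm_num)]
    apply lintegral_mono_ae
    filter_upwards [Measure.ae_ne volume s] with t ht
    rw [inner_U_U]
    refine (enorm_inner_U_le_rpow hα0 hα1.le (t := -t - -s) ?_ _ _).trans_eq ?_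
    · intro h0; apply ht; linarith
    · rw [show -t - -s = s - t by ring]
      ring
  have e6 := e1.trans (e5.trans (mul_le_mul_right (lintegral_lintegral_rieszKernel_le hα0 hα1 hN) 4))
  have h2 : 0 < 2 - α := by linarith
  have e7 : ‖h‖ₑ = (‖h‖ₑ ^ (2 : ℝ)) ^ (1 / 2 : ℝ) := by
    rw [← ENNReal.rpow_mul]; norm_num
  rw [e7, mixedNorm_eq_lintegral (by positivity), strichartzConst]
  refine (ENNReal.rpow_le_rpow e6 (by norm_num)).trans_eq ?_
  rw [← mul_assoc, ENNReal.mul_rpow_of_nonneg _ _ (by norm_num), ← ENNReal.rpow_mul]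
  congr 2
  field_simp

/-- The bilinear estimate for bounded `g` of bounded support whose argument is that of the
solution. -/
lemma lintegral_US_mul_le_of_bounded {α : ℝ} (hα0 : 0 ≤ α) (hα1 : α < 1) (φ : 𝓢(R3, ℂ))
    {g : ℝ → R3 → ℂ} (hg : Measurable (Function.uncurry g)) {R : ℝ}
    (hgR : ∀ t x, ‖g t x‖ ≤ R) (ht : ∀ t x, t ∉ Set.Icc (-R) R → g t x = 0)
    (hx : ∀ t x, x ∉ Metric.closedBall 0 R → g t x = 0)
    (harg : ∀ t x, starRingEnd ℂ (US t φ x) * g t x = (‖US t φ x‖ * ‖g t x‖ : ℝ)) :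
    ∫⁻ t, ∫⁻ x, ‖US t φ x‖ₑ * ‖g t x‖ₑ ≤ ‖φ.toLp 2‖ₑ * (strichartzConst α *
      mixedNorm (ENNReal.ofReal (2 / (2 - α))) (ENNReal.ofReal (2 / (1 + α))) g) := by
  have hgt (t : ℝ) : Measurable (g t) := hg.comp measurable_prodMk_left
  have hb (t : ℝ) : MemLp (g t) 2 volume := by
    have h0 : g t = (Metric.closedBall (0 : R3) R).indicator (g t) := by
      funext x
      by_cases h : x ∈ Metric.closedBall (0 : R3) R
      · rw [Set.indicator_of_mem h]
      · rw [Set.indicator_of_notMem h, hx t x h]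
    rw [h0, memLp_indicator_iff_restrict Metric.isClosed_closedBall.measurableSet]
    have : IsFiniteMeasure (volume.restrict (Metric.closedBall (0 : R3) R)) :=
      ⟨by rw [Measure.restrict_apply_univ]; exact measure_closedBall_lt_top⟩
    exact MemLp.of_bound (hgt t).aestronglyMeasurable R (.of_forall (hgR t))
  -- Boundedness and bounded support put the slices in L², uniformly in t, and make this path
  -- Bochner integrable, as the TT* bound requires.
  let G : ℝ → L2 := fun t => (hb t).toLp (g t)
  have hGae (t : ℝ) : G t =ᵐ[volume] g t := (hb t).coeFn_toLp
  obtain ⟨B, hB⟩ : ∃ B : ℝ, ∀ t, ‖G t‖ ≤ B := by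
    let b : R3 → ℂ := (Metric.closedBall (0 : R3) R).indicator fun _ => (R : ℂ)
    have hbm : MemLp b 2 volume := memLp_indicator_const 2
      Metric.isClosed_closedBall.measurableSet _ (Or.inr measure_closedBall_lt_top.ne)
    refine ⟨‖hbm.toLp b‖, fun t => ?_⟩
    refine Lp.norm_le_norm_of_ae_le ?_
    filter_upwards [hGae t, hbm.coeFn_toLp] with x h1 h2
    rw [h1, h2]
    by_cases h : x ∈ Metric.closedBall (0 : R3) R
    · simp only [b, Set.indicator_of_mem h, Complex.norm_real]
      exact (hgR t x).trans (le_abs_self R)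
    · rw [hx t x h, norm_zero]
      exact norm_nonneg _
  have hGt (t : ℝ) (h : t ∉ Set.Icc (-R) R) : G t = 0 := by
    apply Lp.ext
    filter_upwards [hGae t, Lp.coeFn_zero ℂ 2 (volume : Measure R3)] with x h1 h2
    rw [h1, h2, ht t x h, Pi.zero_apply]
  have hGi : Integrable G := by
    have h0 : G = (Set.Icc (-R) R).indicator G := by
      funext t
      by_cases h : t ∈ Set.Icc (-R) R
      · rw [Set.indicator_of_mem h]
      · rw [Set.indicator_of_notMem h, hGt t h]
    rw [h0, integrable_indicator_iff measurableSet_Icc]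
    exact Measure.integrableOn_of_bounded (by simp) (stronglyMeasurable_toLp hg hb).aestronglyMeasurable
      (.of_forall hB)
  have hpos : 0 < 2 / (1 + α) := by positivity
  have hsp (t : ℝ) : spaceNorm (ENNReal.ofReal (2 / (1 + α))) (G t) =
      spaceNorm (ENNReal.ofReal (2 / (1 + α))) (g t) := spaceNorm_congr_ae _ (hGae t)
  have main := enorm_integral_U_le hα0 hα1 hGi (by
    simp_rw [hsp]
    exact measurable_spaceNorm hpos hg)
  rw [mixedNorm_congr_ae _ _ (.of_forall hGae)] at main
  have hFi : Integrable fun t => U (-t) (G t) := by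
    have hp : AEStronglyMeasurable (fun t => ((-t, G t) : ℝ × L2)) volume :=
      continuous_neg.aestronglyMeasurable.prodMk hGi.aestronglyMeasurable
    have hm : AEStronglyMeasurable (fun t => U (-t) (G t)) volume :=
      Continuous.comp_aestronglyMeasurable (g := fun v : ℝ × L2 => U v.1 v.2)
        (f := fun t => ((-t, G t) : ℝ × L2)) continuous_U hp
    exact hGi.mono hm (.of_forall fun t => (norm_U _ _).le)
  let a : ℝ → ℝ := fun t => ∫ x, ‖US t φ x‖ * ‖g t x‖
  have hai (t : ℝ) : Integrable fun x => ‖US t φ x‖ * ‖g t x‖ := by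
    have h1 : MemLp (US t φ) 2 volume := (US t φ).memLp 2
    exact (h1.norm.integrable_mul (hb t).norm)
  -- Since the phase of g is that of the solution, the pairing is the integral of absolute values
  -- and nothing is lost in it.
  have hinner (t : ℝ) : inner ℂ (φ.toLp 2) (U (-t) (G t)) = ((a t : ℝ) : ℂ) := by
    rw [← inner_U_left, L2.inner_def, ← integral_complex_ofReal]
    apply integral_congr_ae
    filter_upwards [US_ae_eq t φ, hGae t] with x h1 h2
    rw [← h1, h2, RCLike.inner_apply, mul_comm]
    exact harg t x
  have ha0 (t : ℝ) : 0 ≤ a t := integral_nonneg fun x => by positivity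
  have hae : Integrable a := by
    have := (hFi.const_inner (𝕜 := ℂ) (φ.toLp 2)).congr (.of_forall hinner)
    simpa using this.re
  have e1 : ∫⁻ t, ∫⁻ x, ‖US t φ x‖ₑ * ‖g t x‖ₑ = ENNReal.ofReal (∫ t, a t) := by
    rw [ofReal_integral_eq_lintegral_ofReal hae (.of_forall ha0)]
    refine lintegral_congr fun t => ?_
    rw [ofReal_integral_eq_lintegral_ofReal (hai t) (.of_forall fun x => by positivity)]
    refine lintegral_congr fun x => ?_
    rw [ENNReal.ofReal_mul (norm_nonneg _), ofReal_norm, ofReal_norm]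
  have e2 : ENNReal.ofReal (∫ t, a t) = ‖inner ℂ (φ.toLp 2) (∫ t, U (-t) (G t))‖ₑ := by
    rw [← integral_inner hFi, integral_congr_ae (.of_forall hinner), integral_complex_ofReal,
      ← ofReal_norm, Complex.norm_real, Real.norm_of_nonneg (integral_nonneg ha0)]
  rw [e1, e2]
  calc _ ≤ ‖φ.toLp 2‖ₑ * ‖∫ t, U (-t) (G t)‖ₑ := by
        simp only [← ofReal_norm]
        rw [← ENNReal.ofReal_mul (norm_nonneg _)]
        exact ENNReal.ofReal_le_ofReal (norm_inner_le_norm _ _)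
    _ ≤ _ := by gcongr

/-- The bilinear form of the Strichartz estimate, with absolute values. -/
theorem lintegral_US_mul_le {α : ℝ} (hα0 : 0 ≤ α) (hα1 : α < 1) (φ : 𝓢(R3, ℂ))
    {g : ℝ → R3 → ℂ} (hg : Measurable (Function.uncurry g)) :
    ∫⁻ t, ∫⁻ x, ‖US t φ x‖ₑ * ‖g t x‖ₑ ≤ ‖φ.toLp 2‖ₑ * (strichartzConst α *
      mixedNorm (ENNReal.ofReal (2 / (2 - α))) (ENNReal.ofReal (2 / (1 + α))) g) := by
  have hg' : Measurable fun v : ℝ × R3 => g v.1 v.2 := hg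
  have hU : Measurable fun v : ℝ × R3 => US v.1 φ v.2 := (continuous_US φ).measurable
  let E : ℕ → Set (ℝ × R3) := fun n =>
    {v | ‖g v.1 v.2‖ ≤ n} ∩ (Set.Icc (-n : ℝ) n ×ˢ Metric.closedBall 0 n)
  have hE (n : ℕ) : MeasurableSet (E n) :=
    (measurableSet_le hg'.norm measurable_const).inter
      (measurableSet_Icc.prod Metric.isClosed_closedBall.measurableSet)
  have hEmono : Monotone E := by
    intro m n hmn v hv
    have hmn' : (m : ℝ) ≤ n := by exact_mod_cast hmn
    exact ⟨le_trans hv.1 hmn', ⟨(neg_le_neg hmn').trans hv.2.1.1, hv.2.1.2.trans hmn'⟩,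
      Metric.closedBall_subset_closedBall hmn' hv.2.2⟩
  -- The modulus of g with the phase of the solution, truncated. Where the solution vanishes the
  -- quotient is 0 by convention, which is harmless as the integrand vanishes there too.
  let k : ℕ → ℝ × R3 → ℂ := fun n => (E n).indicator fun v =>
    US v.1 φ v.2 / ‖US v.1 φ v.2‖ * ‖g v.1 v.2‖
  have hk (n : ℕ) : Measurable (k n) := by
    refine Measurable.indicator ?_ (hE n)
    fun_prop
  have hknorm (n : ℕ) (v : ℝ × R3) : ‖US v.1 φ v.2‖ₑ * ‖k n v‖ₑ =
      (E n).indicator (fun v => ‖US v.1 φ v.2‖ₑ * ‖g v.1 v.2‖ₑ) v := by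
    by_cases hv : v ∈ E n
    · simp only [k, Set.indicator_of_mem hv]
      by_cases h0 : US v.1 φ v.2 = 0
      · simp [h0]
      · simp only [← ofReal_norm]
        simp [h0]
    · simp [k, Set.indicator_of_notMem hv]
  have hkle (n : ℕ) (v : ℝ × R3) : ‖k n v‖ ≤ ‖g v.1 v.2‖ := by
    refine (norm_indicator_le_norm_self _ _).trans ?_
    rw [norm_mul, norm_div, Complex.norm_real, Complex.norm_real, norm_norm, norm_norm]
    exact mul_le_of_le_one_left (norm_nonneg _) (div_self_le_one _)
  have bound (n : ℕ) : ∫⁻ t, ∫⁻ x, (E n).indicator (fun v => ‖US v.1 φ v.2‖ₑ * ‖g v.1 v.2‖ₑ) (t, x) ≤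
      ‖φ.toLp 2‖ₑ * (strichartzConst α *
      mixedNorm (ENNReal.ofReal (2 / (2 - α))) (ENNReal.ofReal (2 / (1 + α))) g) := by
    simp_rw [← hknorm]
    refine (lintegral_US_mul_le_of_bounded hα0 hα1 φ (g := fun t x => k n (t, x)) (R := n)
      (hk n) ?_ ?_ ?_ ?_).trans ?_
    · intro t x
      by_cases hv : (t, x) ∈ E n
      · exact (hkle n (t, x)).trans hv.1
      · simp [k, Set.indicator_of_notMem hv]
    · intro t x h
      exact Set.indicator_of_notMem (fun hv => h hv.2.1) _
    · intro t x h
      exact Set.indicator_of_notMem (fun hv => h hv.2.2) _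
    · intro t x
      by_cases hv : (t, x) ∈ E n
      · simp only [k, Set.indicator_of_mem hv]
        by_cases h0 : US t φ x = 0
        · simp [h0]
        · rw [norm_mul, norm_div, Complex.norm_real, Complex.norm_real, norm_norm, norm_norm,
            div_self (norm_ne_zero_iff.2 h0), one_mul, ← mul_assoc, mul_div_assoc',
            ← Complex.normSq_eq_conj_mul_self, Complex.normSq_eq_norm_sq]
          push_cast
          have : ((‖US t φ x‖ : ℝ) : ℂ) ≠ 0 := by exact_mod_cast norm_ne_zero_iff.2 h0
          field_simp
      · simp [k, Set.indicator_of_notMem hv]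
    · gcongr
      exact mixedNorm_mono _ _ fun t x => hkle n (t, x)
  have hm : Measurable fun v : ℝ × R3 => ‖US v.1 φ v.2‖ₑ * ‖g v.1 v.2‖ₑ := by fun_prop
  have e1 : ∫⁻ t, ∫⁻ x, ‖US t φ x‖ₑ * ‖g t x‖ₑ =
      ∫⁻ v, ‖US v.1 φ v.2‖ₑ * ‖g v.1 v.2‖ₑ ∂((volume : Measure ℝ).prod (volume : Measure R3)) :=
    (lintegral_prod _ hm.aemeasurable).symm
  have hlim := lintegral_tendsto_of_tendsto_of_monotone
    (μ := (volume : Measure ℝ).prod (volume : Measure R3))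
    (f := fun n => (E n).indicator fun v => ‖US v.1 φ v.2‖ₑ * ‖g v.1 v.2‖ₑ)
    (F := fun v => ‖US v.1 φ v.2‖ₑ * ‖g v.1 v.2‖ₑ)
    (fun n => (hm.indicator (hE n)).aemeasurable)
    (.of_forall fun v m n hmn => Set.indicator_le_indicator_of_subset (hEmono hmn)
      (fun _ => zero_le) v)
    (.of_forall fun v => by
      refine tendsto_const_nhds.congr' ?_
      obtain ⟨m, hm⟩ := exists_nat_ge (max ‖g v.1 v.2‖ (max |v.1| ‖v.2‖))
      filter_upwards [Filter.eventually_ge_atTop m] with n hn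
      rw [Set.indicator_of_mem]
      refine hEmono hn ⟨(le_max_left _ _).trans hm, ?_, ?_⟩
      · exact Set.mem_Icc.2 (abs_le.1 ((le_max_left _ _).trans ((le_max_right _ _).trans hm)))
      · rw [mem_closedBall_zero_iff]
        exact (le_max_right _ _).trans ((le_max_right _ _).trans hm))
  rw [e1]
  refine le_of_tendsto' hlim fun n => ?_
  rw [lintegral_prod _ (hm.indicator (hE n)).aemeasurable]
  exact bound n

/-! ### Duality and the homogeneous estimate -/

lemma ennreal_rpow_add_one {a : ℝ≥0∞} (y : ℝ) (h0 : a ≠ 0) (h : a ≠ ∞) :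
    a ^ (y + 1) = a ^ y * a := by
  rw [ENNReal.rpow_add _ _ h0 h, ENNReal.rpow_one]

/-- Absorption of the extremiser of the duality pairing of the mixed norms. The function `N` is
the `L²_z` norm of `F`, and `M` a truncation of `N`. -/
lemma lintegral_rpow_le_of_duality {α : ℝ} (hα0 : 0 < α) (hα1 : α < 1) {C : ℝ≥0∞}
    {F : ℝ → R3 → ℂ} (hF : Measurable (Function.uncurry F))
    (hC : ∀ g : ℝ → R3 → ℂ, Measurable (Function.uncurry g) →
      ∫⁻ t, ∫⁻ x, ‖F t x‖ₑ * ‖g t x‖ₑ ≤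
        C * mixedNorm (ENNReal.ofReal (2 / (2 - α))) (ENNReal.ofReal (2 / (1 + α))) g)
    {M : ℝ → ℝ × ℝ → ℝ≥0∞} (hM : Measurable (Function.uncurry M))
    (hMN : ∀ t w, M t w = 0 ∨ M t w = zNorm (F t) w) (hMtop : ∀ t w, M t w ≠ ∞)
    (hJ : ∀ t, ∫⁻ w, M t w ^ (2 / (1 - α)) ≠ ∞)
    (hI : ∫⁻ t, (∫⁻ w, M t w ^ (2 / (1 - α))) ^ ((1 - α) / α) ≠ ∞) :
    (∫⁻ t, (∫⁻ w, M t w ^ (2 / (1 - α))) ^ ((1 - α) / α)) ^ (α / 2) ≤ C := by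
  set P : ℝ := 2 / (1 - α) with hP
  have h1α : 0 < 1 - α := by linarith
  have h2α : 0 < 2 - α := by linarith
  have hP2 : 2 < P := by rw [hP, lt_div_iff₀ h1α]; linarith
  have hPM (p : ℝ) : Measurable fun v : ℝ × (ℝ × ℝ) => M v.1 v.2 ^ p := hM.pow_const p
  let J : ℝ → ℝ≥0∞ := fun t => ∫⁻ w, M t w ^ P
  have hJm : Measurable J := (hPM P).lintegral_prod_right'
  set β : ℝ := (1 - α) / α with hβ
  have hβ0 : 0 < β := by positivity
  -- The extremiser of Hölder's inequality in L^q_t L^p_{xy} is cF, with P = p and β = q/p. Its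
  -- pairing with F is at least I = ∫ J^β, and the q'-th power of its dual norm is at most I.
  let c : ℝ → ℝ × ℝ → ℝ≥0∞ := fun t w => M t w ^ (P - 2) * J t ^ (β - 1)
  have hcm : Measurable (Function.uncurry c) :=
    (hPM (P - 2)).mul ((hJm.comp measurable_fst).pow_const (β - 1))
  let g : ℝ → R3 → ℂ := fun t x => ((c t (xy x)).toReal : ℂ) * F t x
  have hgm : Measurable (Function.uncurry g) := by
    have h1 : Measurable fun v : ℝ × R3 => c v.1 (xy v.2) :=
      hcm.comp (measurable_fst.prodMk (measurable_xy.comp measurable_snd))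
    exact (Complex.measurable_ofReal.comp h1.ennreal_toReal).mul hF
  -- When J t = 0 and β < 1 the factor J t ^ (β - 1) is infinite; the product still vanishes because
  -- 0 · ∞ = 0.
  have hJ0 (t : ℝ) (h : J t = 0) (w : ℝ × ℝ) (hw : M t w = 0) : c t w = 0 := by
    simp only [c, hw, ENNReal.zero_rpow_of_pos (show 0 < P - 2 by linarith), zero_mul]
  have hctop (t : ℝ) (h : J t ≠ 0) (w : ℝ × ℝ) : c t w ≠ ∞ :=
    ENNReal.mul_ne_top (ENNReal.rpow_ne_top_of_nonneg (by linarith) (hMtop t w))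
      (ENNReal.rpow_ne_top_of_ne_zero h (hJ t))
  have hz (t : ℝ) (w : ℝ × ℝ) : zNorm (g t) w = ENNReal.ofReal (c t w).toReal * zNorm (F t) w := by
    have := zNorm_mul (fun w => ((c t w).toReal : ℂ)) (F t) w
    rw [← ofReal_norm, Complex.norm_real, Real.norm_of_nonneg ENNReal.toReal_nonneg] at this
    exact this
  have hsplit (t : ℝ) : ∫⁻ x, ‖F t x‖ₑ * ‖g t x‖ₑ =
      ∫⁻ w, ENNReal.ofReal (c t w).toReal * zNorm (F t) w ^ (2 : ℝ) := by
    have hFt : Measurable (F t) := hF.of_uncurry_left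
    have hgt : Measurable (g t) := hgm.of_uncurry_left
    rw [← lintegral_splitEquiv (fun x => ‖F t x‖ₑ * ‖g t x‖ₑ) (hFt.enorm.mul hgt.enorm)]
    refine lintegral_congr fun w => ?_
    rw [zNorm_sq, ← lintegral_const_mul' _ _ (by simp)]
    refine lintegral_congr fun z => ?_
    simp only [g, xy_splitEquiv, enorm_mul, ENNReal.rpow_two]
    rw [← ofReal_norm ((c t w).toReal : ℂ), Complex.norm_real,
      Real.norm_of_nonneg ENNReal.toReal_nonneg]
    ring
  have hlow (t : ℝ) : J t ^ β ≤ ∫⁻ x, ‖F t x‖ₑ * ‖g t x‖ₑ := by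
    by_cases h : J t = 0
    · rw [h, ENNReal.zero_rpow_of_pos hβ0]; exact zero_le
    rw [hsplit]
    calc J t ^ β = J t ^ (β - 1) * J t := by
          rw [← ennreal_rpow_add_one _ h (hJ t)]; congr 1; ring
      _ = ∫⁻ w, J t ^ (β - 1) * M t w ^ P := by
          rw [lintegral_const_mul' _ _ (ENNReal.rpow_ne_top_of_ne_zero h (hJ t))]
      _ ≤ _ := by
          refine lintegral_mono fun w => ?_
          rw [ENNReal.ofReal_toReal (hctop t h w)]
          rcases eq_or_ne (M t w) 0 with h0 | h0
          · rw [h0, ENNReal.zero_rpow_of_pos (by linarith), mul_zero]; exact zero_le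
          · rw [← (hMN t w).resolve_left h0]
            simp only [c]
            rw [mul_comm (M t w ^ (P - 2)), mul_assoc, ← ENNReal.rpow_add _ _ h0 (hMtop t w)]
            simp
  set P' : ℝ := 2 / (1 + α) with hP'
  set Q' : ℝ := 2 / (2 - α) with hQ'
  have hP'0 : 0 < P' := by positivity
  have hQ'0 : 0 < Q' := by positivity
  have hup (t : ℝ) : spaceNorm (ENNReal.ofReal P') (g t) ^ Q' ≤ J t ^ β := by
    rw [spaceNorm_eq_lintegral hP'0]
    by_cases h : J t = 0
    · have hM0 : ∀ᵐ w, M t w = 0 := by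
        have hm : Measurable fun w => M t w ^ P := (hPM P).comp measurable_prodMk_left
        have := (lintegral_eq_zero_iff hm).1 h
        filter_upwards [this] with w hw
        exact (ENNReal.rpow_eq_zero_iff_of_pos (by linarith)).1 hw
      have : ∫⁻ w, zNorm (g t) w ^ P' = 0 := by
        rw [← lintegral_zero (μ := (volume : Measure (ℝ × ℝ)))]
        apply lintegral_congr_ae
        filter_upwards [hM0] with w hw
        rw [hz, hJ0 t h w hw]
        simp [hP'0]
      rw [this, ENNReal.zero_rpow_of_pos (by positivity), ENNReal.zero_rpow_of_pos hQ'0]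
      exact zero_le
    · have : ∫⁻ w, zNorm (g t) w ^ P' = J t ^ ((β - 1) * P' + 1) := by
        calc _ = ∫⁻ w, J t ^ ((β - 1) * P') * M t w ^ P := by
              refine lintegral_congr fun w => ?_
              rw [hz, ENNReal.ofReal_toReal (hctop t h w)]
              rcases eq_or_ne (M t w) 0 with h0 | h0
              · simp only [c, h0, ENNReal.zero_rpow_of_pos (show 0 < P - 2 by linarith),
                  ENNReal.zero_rpow_of_pos (show 0 < P by linarith), zero_mul, mul_zero,
                  ENNReal.zero_rpow_of_pos hP'0]
              · rw [← (hMN t w).resolve_left h0]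
                simp only [c]
                rw [mul_right_comm, ← ennreal_rpow_add_one _ h0 (hMtop t w),
                  ENNReal.mul_rpow_of_nonneg _ _ hP'0.le, ← ENNReal.rpow_mul, ← ENNReal.rpow_mul,
                  mul_comm]
                congr 2
                rw [hP, hP']; field_simp; ring
          _ = J t ^ ((β - 1) * P') * J t := by
              rw [lintegral_const_mul' _ _ (ENNReal.rpow_ne_top_of_ne_zero h (hJ t))]
          _ = _ := by rw [ennreal_rpow_add_one _ h (hJ t)]
      rw [this, ← ENNReal.rpow_mul, ← ENNReal.rpow_mul]
      refine le_of_eq ?_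
      congr 1
      rw [hβ, hP', hQ']
      field_simp
      ring
  set I := ∫⁻ t, J t ^ β with hIdef
  have main : I ≤ C * I ^ (1 / Q') := by
    calc I ≤ ∫⁻ t, ∫⁻ x, ‖F t x‖ₑ * ‖g t x‖ₑ := lintegral_mono hlow
      _ ≤ _ := hC g hgm
      _ ≤ _ := by
        rw [mixedNorm_eq_lintegral hQ'0]
        exact mul_le_mul_right (ENNReal.rpow_le_rpow (lintegral_mono hup) (by positivity)) _
  -- From I ≤ C I^(1/q') the power is cancelled, which is legitimate because the truncation makes I
  -- finite; 1 - 1/q' = α/2 = 1/q.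
  change I ^ (α / 2) ≤ C
  by_cases hI0 : I = 0
  · rw [hI0, ENNReal.zero_rpow_of_pos (by positivity)]; exact zero_le
  have hIp0 : I ^ (1 / Q') ≠ 0 := (ENNReal.rpow_pos (pos_iff_ne_zero.2 hI0) hI).ne'
  have hIpt : I ^ (1 / Q') ≠ ∞ := ENNReal.rpow_ne_top_of_nonneg (by positivity) hI
  have e : I = I ^ (α / 2) * I ^ (1 / Q') := by
    rw [← ENNReal.rpow_add _ _ hI0 hI]
    have : α / 2 + 1 / Q' = 1 := by rw [hQ']; field_simp; ring
    rw [this, ENNReal.rpow_one]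
  exact (ENNReal.mul_le_mul_iff_left hIp0 hIpt).1 (e.symm.trans_le main)

/-- Truncation of a measurable function on space-time to bounded functions of bounded support. -/
lemma exists_truncation {N : ℝ → ℝ × ℝ → ℝ≥0∞} (hN : Measurable (Function.uncurry N)) :
    ∃ M : ℕ → ℝ → ℝ × ℝ → ℝ≥0∞, (∀ n, Measurable (Function.uncurry (M n))) ∧
      (∀ n t w, M n t w = 0 ∨ M n t w = N t w) ∧
      (∀ n t w, M n t w ≤ (Metric.closedBall (0 : ℝ × ℝ) n).indicator (fun _ => (n : ℝ≥0∞)) w) ∧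
      (∀ (n : ℕ) t w, t ∉ Set.Icc (-n : ℝ) n → M n t w = 0) ∧
      (∀ t w, Monotone fun n => M n t w) ∧
      ∀ t w, N t w ≠ ∞ → ∀ᶠ n in Filter.atTop, M n t w = N t w := by
  let E : ℕ → Set (ℝ × (ℝ × ℝ)) := fun n =>
    {v | Function.uncurry N v ≤ n} ∩ (Set.Icc (-n : ℝ) n ×ˢ Metric.closedBall 0 n)
  have hE (n : ℕ) : MeasurableSet (E n) :=
    (measurableSet_le hN measurable_const).inter
      (measurableSet_Icc.prod Metric.isClosed_closedBall.measurableSet)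
  have hEmono : Monotone E := by
    intro m n hmn v hv
    have hmn' : (m : ℝ) ≤ n := by exact_mod_cast hmn
    have hmn'' : (m : ℝ≥0∞) ≤ n := by exact_mod_cast hmn
    exact ⟨le_trans hv.1 hmn'', ⟨(neg_le_neg hmn').trans hv.2.1.1, hv.2.1.2.trans hmn'⟩,
      Metric.closedBall_subset_closedBall hmn' hv.2.2⟩
  refine ⟨fun n t w => (E n).indicator (Function.uncurry N) (t, w), fun n => hN.indicator (hE n),
    fun n t w => ?_, fun n t w => ?_, fun n t w ht => ?_, fun t w m n hmn => ?_,
    fun t w h => ?_⟩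
  · by_cases hv : (t, w) ∈ E n
    · exact Or.inr (Set.indicator_of_mem hv _)
    · exact Or.inl (Set.indicator_of_notMem hv _)
  · by_cases hv : (t, w) ∈ E n
    · simp only [Set.indicator_of_mem hv, Set.indicator_of_mem hv.2.2]
      exact hv.1
    · simp [Set.indicator_of_notMem hv]
  · exact Set.indicator_of_notMem (fun hv => ht hv.2.1) _
  · exact Set.indicator_le_indicator_of_subset (hEmono hmn) (fun _ => zero_le) _
  · obtain ⟨m, hm⟩ := exists_nat_ge (max (N t w).toReal (max |t| ‖w‖))
    filter_upwards [Filter.eventually_ge_atTop m] with n hn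
    have : (t, w) ∈ E n := by
      refine hEmono hn ⟨?_, ?_, ?_⟩
      · change N t w ≤ m
        rw [← ENNReal.ofReal_toReal h, ← ENNReal.ofReal_natCast]
        exact ENNReal.ofReal_le_ofReal ((le_max_left _ _).trans hm)
      · exact Set.mem_Icc.2 (abs_le.1 ((le_max_left _ _).trans ((le_max_right _ _).trans hm)))
      · rw [mem_closedBall_zero_iff]
        exact (le_max_right _ _).trans ((le_max_right _ _).trans hm)
    rw [Set.indicator_of_mem this]
    rfl

lemma measurable_US (φ : 𝓢(R3, ℂ)) : Measurable (Function.uncurry fun t => (US t φ : R3 → ℂ)) :=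
  (continuous_US φ).measurable

lemma measurable_zNorm_US (φ : 𝓢(R3, ℂ)) :
    Measurable (Function.uncurry fun t => zNorm (US t φ)) :=
  measurable_zNorm_uncurry (g := fun t => US t φ) (measurable_US φ)

/-- The homogeneous Strichartz estimate for Schwartz functions. -/
lemma mixedNorm_US_le {α : ℝ} (hα0 : 0 < α) (hα1 : α < 1) (φ : 𝓢(R3, ℂ)) :
    mixedNorm (ENNReal.ofReal (2 / α)) (ENNReal.ofReal (2 / (1 - α))) (fun t => US t φ) ≤
      strichartzConst α * ‖φ.toLp 2‖ₑ := by
  have h1α : 0 < 1 - α := by linarith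
  have hP0 : 0 < 2 / (1 - α) := by positivity
  have hβ0 : 0 < (1 - α) / α := by positivity
  -- Finiteness of the norm is not known beforehand, so the absorption is carried out on
  -- truncations, and monotone convergence in w and then in t recovers the full norm.
  obtain ⟨M, hM, hMN, hMle, hMt, hMmono, hMev⟩ := exists_truncation (measurable_zNorm_US φ)
  have e : mixedNorm (ENNReal.ofReal (2 / α)) (ENNReal.ofReal (2 / (1 - α))) (fun t => US t φ) =
      (∫⁻ t, (∫⁻ w, zNorm (US t φ) w ^ (2 / (1 - α))) ^ ((1 - α) / α)) ^ (α / 2) := by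
    rw [mixedNorm_eq_lintegral (by positivity), one_div_div]
    congr 1
    refine lintegral_congr fun t => ?_
    rw [spaceNorm_eq_lintegral hP0, ← ENNReal.rpow_mul]
    congr 1
    field_simp
  rw [e]
  generalize hPdef : 2 / (1 - α) = P at *
  have hMP (n : ℕ) : Measurable fun v : ℝ × (ℝ × ℝ) => M n v.1 v.2 ^ P := (hM n).pow_const P
  have hJle (n : ℕ) (t : ℝ) : ∫⁻ w, M n t w ^ P ≤
      (n : ℝ≥0∞) ^ P * volume (Metric.closedBall (0 : ℝ × ℝ) n) := by
    rw [← setLIntegral_const, ← lintegral_indicator Metric.isClosed_closedBall.measurableSet]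
    refine lintegral_mono fun w => ?_
    refine (ENNReal.rpow_le_rpow (hMle n t w) hP0.le).trans_eq ?_
    by_cases hw : w ∈ Metric.closedBall (0 : ℝ × ℝ) n
    · simp only [Set.indicator_of_mem hw]
    · simp only [Set.indicator_of_notMem hw, ENNReal.zero_rpow_of_pos hP0]
  have hBtop (n : ℕ) : (n : ℝ≥0∞) ^ P * volume (Metric.closedBall (0 : ℝ × ℝ) n) ≠ ∞ :=
    ENNReal.mul_ne_top (ENNReal.rpow_ne_top_of_nonneg hP0.le (by simp))
      measure_closedBall_lt_top.ne
  have hI (n : ℕ) : ∫⁻ t, (∫⁻ w, M n t w ^ P) ^ ((1 - α) / α) ≠ ∞ := by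
    refine ne_top_of_le_ne_top (b := ((n : ℝ≥0∞) ^ P *
      volume (Metric.closedBall (0 : ℝ × ℝ) n)) ^ ((1 - α) / α) * volume (Set.Icc (-n : ℝ) n)) ?_ ?_
    · exact ENNReal.mul_ne_top (ENNReal.rpow_ne_top_of_nonneg hβ0.le (hBtop n)) (by simp)
    · rw [← setLIntegral_const, ← lintegral_indicator measurableSet_Icc]
      refine lintegral_mono fun t => ?_
      by_cases ht : t ∈ Set.Icc (-n : ℝ) n
      · rw [Set.indicator_of_mem ht]
        exact ENNReal.rpow_le_rpow (hJle n t) hβ0.le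
      · have h0 (w : ℝ × ℝ) : M n t w = 0 := hMt n t w ht
        simp [h0, ENNReal.zero_rpow_of_pos hP0, ENNReal.zero_rpow_of_pos hβ0]
  have bound (n : ℕ) : (∫⁻ t, (∫⁻ w, M n t w ^ P) ^ ((1 - α) / α)) ^ (α / 2) ≤
      strichartzConst α * ‖φ.toLp 2‖ₑ := by
    subst hPdef
    refine lintegral_rpow_le_of_duality hα0 hα1 (measurable_US φ) (fun g hg => ?_) (hM n) (hMN n)
      (fun t w => ne_top_of_le_ne_top (b := (n : ℝ≥0∞)) (by simp)
        ((hMle n t w).trans (Set.indicator_le_self _ _ _)))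
      (fun t => ne_top_of_le_ne_top (hBtop n) (hJle n t)) (hI n)
    exact (lintegral_US_mul_le hα0.le hα1 φ hg).trans_eq (by rw [mul_left_comm, mul_assoc])
  have hMlim (t : ℝ) : ∀ᵐ w, Filter.Tendsto (fun n => M n t w ^ P) Filter.atTop
      (nhds (zNorm (US t φ) w ^ P)) := by
    filter_upwards [zNorm_congr_ae (US_ae_eq t φ), ae_zNorm_ne_top (U t (φ.toLp 2))] with w h1 h2
    rw [← h1] at h2
    refine tendsto_const_nhds.congr' ?_
    filter_upwards [hMev t w h2] with n hn
    rw [hn]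
  have hJlim (t : ℝ) : Filter.Tendsto (fun n => ∫⁻ w, M n t w ^ P) Filter.atTop
      (nhds (∫⁻ w, zNorm (US t φ) w ^ P)) :=
    lintegral_tendsto_of_tendsto_of_monotone
      (fun n => ((hM n).of_uncurry_left.pow_const P).aemeasurable)
      (.of_forall fun w m n hmn => ENNReal.rpow_le_rpow (hMmono t w hmn) hP0.le) (hMlim t)
  have hIlim : Filter.Tendsto (fun n => ∫⁻ t, (∫⁻ w, M n t w ^ P) ^ ((1 - α) / α)) Filter.atTop
      (nhds (∫⁻ t, (∫⁻ w, zNorm (US t φ) w ^ P) ^ ((1 - α) / α))) :=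
    lintegral_tendsto_of_tendsto_of_monotone
      (fun n => ((hMP n).lintegral_prod_right'.pow_const _).aemeasurable)
      (.of_forall fun t m n hmn => ENNReal.rpow_le_rpow (lintegral_mono fun w =>
        ENNReal.rpow_le_rpow (hMmono t w hmn) hP0.le) hβ0.le)
      (.of_forall fun t => ((ENNReal.continuous_rpow_const (y := (1 - α) / α)).tendsto _).comp
        (hJlim t))
  have hlim := ((ENNReal.continuous_rpow_const (y := α / 2)).tendsto _).comp hIlim
  exact le_of_tendsto' hlim bound

/-- The homogeneous Strichartz estimate. -/
theorem mixedNorm_U_le {α : ℝ} (hα0 : 0 < α) (hα1 : α < 1) (f : L2) :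
    mixedNorm (ENNReal.ofReal (2 / α)) (ENNReal.ofReal (2 / (1 - α))) (fun t => U t f) ≤
      strichartzConst α * ‖f‖ₑ := by
  have h1α : 0 < 1 - α := by linarith
  have hP0 : 0 < 2 / (1 - α) := by positivity
  have hQ0 : 0 < 2 / α := by positivity
  have hd := SchwartzMap.denseRange_toLpCLM (E := R3) (F := ℂ) (p := 2) (μ := volume)
    ENNReal.ofNat_ne_top
  obtain ⟨u, hu, hlim⟩ := mem_closure_iff_seq_limit.1 (hd f)
  choose φ hφ using hu
  have hφ' (n : ℕ) : (φ n).toLp 2 = u n := hφ n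
  have h1 (n : ℕ) : mixedNorm (ENNReal.ofReal (2 / α)) (ENNReal.ofReal (2 / (1 - α)))
      (fun t => U t (u n)) ≤ strichartzConst α * ‖u n‖ₑ := by
    rw [← hφ' n, ← mixedNorm_congr_ae _ _ (.of_forall fun t => US_ae_eq t (φ n))]
    exact mixedNorm_US_le hα0 hα1 (φ n)
  have h2 : mixedNorm (ENNReal.ofReal (2 / α)) (ENNReal.ofReal (2 / (1 - α))) (fun t => U t f) ≤
      Filter.liminf (fun n => mixedNorm (ENNReal.ofReal (2 / α)) (ENNReal.ofReal (2 / (1 - α)))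
        (fun t => U t (u n))) Filter.atTop := by
    simp_rw [mixedNorm_eq_lintegral hQ0]
    -- Lower semicontinuity of the spatial norm at each fixed t, then Fatou's lemma in t.
    refine lintegral_rpow_liminf_le hQ0 (fun n => (measurable_spaceNorm_U hP0 (u n)).aemeasurable)
      (.of_forall fun t => ?_)
    have hU : Filter.Tendsto (fun n => U t (u n)) Filter.atTop (nhds (U t f)) :=
      ((UL t).continuous.tendsto f).comp hlim
    have h3 := (lowerSemicontinuous_spaceNorm hP0).le_liminf (U t f)
    refine h3.trans ?_
    exact Filter.liminf_le_liminf_of_le hU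
  refine h2.trans ?_
  refine (Filter.liminf_le_liminf (.of_forall h1)).trans_eq ?_
  exact (ENNReal.Tendsto.const_mul hlim.enorm (Or.inr (strichartzConst_ne_top α))).liminf_eq

/-! ### Existence of the group integrals -/

lemma US_US (s t : ℝ) (φ : 𝓢(R3, ℂ)) : US s (US t φ) = US (s + t) φ := by
  refine SchwartzMap.injective_toLp 2 (volume : Measure R3) ?_
  change (US s (US t φ)).toLp 2 = (US (s + t) φ).toLp 2
  rw [← U_toLp, ← U_toLp, ← U_toLp]
  refine ext_inner_left ℂ fun f => ?_
  rw [← neg_neg s, ← inner_U_left, inner_U_U, sub_neg_eq_add, neg_neg, add_comm]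

lemma inner_toLp (φ : 𝓢(R3, ℂ)) (k : L2) :
    inner ℂ (φ.toLp 2) k = ∫ x : R3, starRingEnd ℂ (φ x) * k x := by
  rw [L2.inner_def]
  apply integral_congr_ae
  filter_upwards [SchwartzMap.coeFn_toLp φ 2 (volume : Measure R3)] with x hx
  rw [hx, RCLike.inner_apply, mul_comm]

/-- Existence of the group integral from the bilinear estimate. -/
lemma exists_isGroupIntegral {σ : ℝ → ℝ} (hσ : Continuous σ) {K : ℝ≥0∞} (hK : K ≠ ∞)
    {g : ℝ → R3 → ℂ} (hg : AEStronglyMeasurable (fun v : ℝ × R3 => g v.1 v.2) volume)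
    (hb : ∀ φ : 𝓢(R3, ℂ), ∫⁻ t, ∫⁻ x, ‖US (-σ t) φ x‖ₑ * ‖g t x‖ₑ ≤ ‖φ.toLp 2‖ₑ * K) :
    ∃ h : L2, IsGroupIntegral σ g h ∧ ‖h‖ₑ ≤ K := by
  have hUm (φ : 𝓢(R3, ℂ)) : Continuous fun v : ℝ × R3 => US (-σ v.1) φ v.2 :=
    (continuous_US φ).comp (f := fun v : ℝ × R3 => (-σ v.1, v.2)) (by fun_prop)
  have hbound (φ : 𝓢(R3, ℂ)) :
      ∫⁻ v : ℝ × R3, ‖US (-σ v.1) φ v.2 * starRingEnd ℂ (g v.1 v.2)‖ₑ ≤ ‖φ.toLp 2‖ₑ * K := by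
    refine le_trans (le_of_eq ?_) (hb φ)
    rw [Measure.volume_eq_prod, lintegral_prod _ ?_]
    · simp only [enorm_mul, RCLike.enorm_conj]
    · exact ((hUm φ).aestronglyMeasurable.mul
        (RCLike.continuous_conj.comp_aestronglyMeasurable hg)).enorm
  have hi (φ : 𝓢(R3, ℂ)) :
      Integrable fun v : ℝ × R3 => US (-σ v.1) φ v.2 * starRingEnd ℂ (g v.1 v.2) := by
    refine ⟨(hUm φ).aestronglyMeasurable.mul
        (RCLike.continuous_conj.comp_aestronglyMeasurable hg), ?_⟩
    exact (hbound φ).trans_lt (ENNReal.mul_lt_top enorm_lt_top hK.lt_top)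
  -- The conjugate of the defining pairing, so as to be linear in φ. The bilinear estimate bounds it
  -- in the L² norm; it extends from the dense Schwartz functions to L², and its Riesz
  -- representative is the integral.
  let L : 𝓢(R3, ℂ) →ₗ[ℂ] ℂ :=
    { toFun := fun φ => ∫ v : ℝ × R3, US (-σ v.1) φ v.2 * starRingEnd ℂ (g v.1 v.2)
      map_add' := fun φ ψ => by
        rw [← integral_add (hi φ) (hi ψ)]
        refine integral_congr_ae (.of_forall fun v => ?_)
        simp only [US, map_add, add_apply, add_mul]
      map_smul' := fun c φ => by
        rw [RingHom.id_apply, ← integral_smul]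
        refine integral_congr_ae (.of_forall fun v => ?_)
        simp only [US, map_smul, smul_apply, smul_eq_mul, mul_assoc] }
  let e : 𝓢(R3, ℂ) →ₗ[ℂ] L2 :=
    (SchwartzMap.toLpCLM ℂ ℂ 2 (volume : Measure R3) : 𝓢(R3, ℂ) →L[ℂ] L2).toLinearMap
  have he (φ : 𝓢(R3, ℂ)) : e φ = φ.toLp 2 := rfl
  have hd : DenseRange e := SchwartzMap.denseRange_toLpCLM (E := R3) (F := ℂ) (p := 2)
    (μ := volume) ENNReal.ofNat_ne_top
  have hL (φ : 𝓢(R3, ℂ)) : ‖L φ‖ ≤ K.toReal * ‖e φ‖ := by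
    have h1 : ‖L φ‖ₑ ≤ ‖e φ‖ₑ * K := (enorm_integral_le_lintegral_enorm _).trans (hbound φ)
    have h2 := ENNReal.toReal_mono (ENNReal.mul_ne_top enorm_ne_top hK) h1
    rwa [ENNReal.toReal_mul, toReal_enorm, toReal_enorm, mul_comm] at h2
  let T : L2 →L[ℂ] ℂ := L.extendOfNorm e
  have hT (φ : 𝓢(R3, ℂ)) : T (φ.toLp 2) = L φ :=
    LinearMap.extendOfNorm_eq hd ⟨_, hL⟩ φ
  have hTn : ‖T‖ ≤ K.toReal := LinearMap.opNorm_extendOfNorm_le hd ENNReal.toReal_nonneg hL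
  refine ⟨(InnerProductSpace.toDual ℂ L2).symm T, fun φ => ⟨?_, ?_⟩, ?_⟩
  · refine (hi φ).mono
      ((RCLike.continuous_conj.comp (hUm φ)).aestronglyMeasurable.mul hg) (.of_forall fun v => ?_)
    simp only [norm_mul, RCLike.norm_conj, le_refl]
  · have hii := (hi φ)
    rw [← inner_toLp, ← inner_conj_symm, InnerProductSpace.toDual_symm_apply, hT]
    change starRingEnd ℂ (∫ v : ℝ × R3, US (-σ v.1) φ v.2 * starRingEnd ℂ (g v.1 v.2)) = _
    rw [Measure.volume_eq_prod] at hii ⊢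
    rw [integral_prod _ hii, ← integral_conj]
    refine integral_congr_ae (.of_forall fun t => ?_)
    simp only [← integral_conj, map_mul, Complex.conj_conj]
  · rw [← ofReal_norm, LinearIsometryEquiv.norm_map]
    exact (ENNReal.ofReal_le_ofReal hTn).trans_eq (ENNReal.ofReal_toReal hK)

lemma mixedNorm_neg {q : ℝ} (hq : 0 < q) (p : ℝ≥0∞) (g : ℝ → R3 → ℂ) :
    mixedNorm (ENNReal.ofReal q) p (fun t => g (-t)) = mixedNorm (ENNReal.ofReal q) p g := by
  rw [mixedNorm_eq_lintegral hq, mixedNorm_eq_lintegral hq]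
  congr 1
  exact (Measure.measurePreserving_neg (volume : Measure ℝ)).lintegral_comp_emb
    (MeasurableEquiv.neg ℝ).measurableEmbedding fun t => spaceNorm p (g t) ^ q

/-- The bilinear form of the Strichartz estimate in both directions of time. -/
lemma lintegral_US_mul_le' {α : ℝ} (hα0 : 0 ≤ α) (hα1 : α < 1) (φ : 𝓢(R3, ℂ))
    {g : ℝ → R3 → ℂ} (hg : AEStronglyMeasurable (fun v : ℝ × R3 => g v.1 v.2) volume) :
    (∫⁻ t, ∫⁻ x, ‖US t φ x‖ₑ * ‖g t x‖ₑ ≤ ‖φ.toLp 2‖ₑ * (strichartzConst α *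
      mixedNorm (ENNReal.ofReal (2 / (2 - α))) (ENNReal.ofReal (2 / (1 + α))) g)) ∧
    ∫⁻ t, ∫⁻ x, ‖US (-t) φ x‖ₑ * ‖g t x‖ₑ ≤ ‖φ.toLp 2‖ₑ * (strichartzConst α *
      mixedNorm (ENNReal.ofReal (2 / (2 - α))) (ENNReal.ofReal (2 / (1 + α))) g) := by
  have hQ : 0 < 2 / (2 - α) := div_pos two_pos (by linarith)
  let k : ℝ → R3 → ℂ := fun t x => hg.mk _ (t, x)
  have hk : Measurable (Function.uncurry k) := hg.stronglyMeasurable_mk.measurable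
  have hgk : ∀ᵐ t, g t =ᵐ[volume] k t :=
    Measure.ae_ae_of_ae_prod hg.ae_eq_mk
  have hcongr (r : ℝ → ℝ) : ∫⁻ t, ∫⁻ x, ‖US (r t) φ x‖ₑ * ‖g t x‖ₑ =
      ∫⁻ t, ∫⁻ x, ‖US (r t) φ x‖ₑ * ‖k t x‖ₑ := by
    apply lintegral_congr_ae
    filter_upwards [hgk] with t ht
    apply lintegral_congr_ae
    filter_upwards [ht] with x hx
    rw [hx]
  rw [mixedNorm_congr_ae _ _ hgk]
  constructor
  · rw [hcongr fun t => t]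
    exact lintegral_US_mul_le hα0 hα1 φ hk
  -- The reflection t ↦ -t preserves the mixed norm and exchanges the two directions of time.
  · rw [hcongr fun t => -t, ← mixedNorm_neg hQ]
    have hk' : Measurable (Function.uncurry fun t => k (-t)) :=
      hk.comp (by fun_prop : Measurable fun v : ℝ × R3 => (-v.1, v.2))
    refine le_trans (le_of_eq ?_) (lintegral_US_mul_le hα0 hα1 φ hk')
    have := (Measure.measurePreserving_neg (volume : Measure ℝ)).lintegral_comp_emb
      (MeasurableEquiv.neg ℝ).measurableEmbedding fun t => ∫⁻ x, ‖US t φ x‖ₑ * ‖k (-t) x‖ₑ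
    rw [← this]
    simp only [neg_neg]

/-- Moving U(t) onto the test function, ⟨φ, U(t)h⟩ = ⟨U(-t)φ, h⟩, and the group law does the rest.
Integration over all of ℝ is essential: the factor U(t) comes out because the domain does not depend
on t. -/
lemma IsGroupIntegral.translate {g : ℝ → R3 → ℂ} {h : L2}
    (H : IsGroupIntegral (fun s => -s) g h) (t : ℝ) :
    IsGroupIntegral (fun s => t - s) g (U t h) := by
  intro φ
  obtain ⟨h1, h2⟩ := H (US (-t) φ)
  have e (s : ℝ) : US (- -s) (US (-t) φ) = US (-(t - s)) φ := by
    rw [US_US]; congr 1; ring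
  simp only [e] at h1 h2
  refine ⟨h1, h2.symm ▸ ?_⟩
  rw [← inner_toLp, ← inner_toLp, ← U_toLp, inner_U_left, neg_neg]

/-! ### Exponents and conclusion -/

/-- Parametrization of the admissible exponents. -/
lemma exists_admissible {p q p' q' : ℝ≥0∞} (hp2 : 2 ≤ p) (hp : p < ∞)
    (hq : 2 / q = 1 - 2 / p) (hpp' : 1 / p + 1 / p' = 1) (hqq' : 1 / q + 1 / q' = 1) :
    ∃ α : ℝ, 0 ≤ α ∧ α < 1 ∧ p = ENNReal.ofReal (2 / (1 - α)) ∧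
      p' = ENNReal.ofReal (2 / (1 + α)) ∧ q' = ENNReal.ofReal (2 / (2 - α)) ∧
      (α = 0 ∧ q = ∞ ∨ 0 < α ∧ q = ENNReal.ofReal (2 / α)) := by
  have inv {r : ℝ≥0∞} {x : ℝ} (hx : 0 < x) (h : r⁻¹ = ENNReal.ofReal (x / 2)) :
      r = ENNReal.ofReal (2 / x) := by
    rw [← inv_inv r, h, ← ENNReal.ofReal_inv_of_pos (by positivity), inv_div]
  have dual {r : ℝ≥0∞} {x : ℝ} (hx0 : 0 ≤ x) (h : ENNReal.ofReal (x / 2) + r⁻¹ = 1) :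
      r⁻¹ = ENNReal.ofReal ((2 - x) / 2) := by
    rw [ENNReal.eq_sub_of_add_eq (by simp) ((add_comm _ _).trans h), ← ENNReal.ofReal_one,
      ← ENNReal.ofReal_sub _ (by positivity)]
    congr 1
    ring
  have half {r : ℝ≥0∞} {x : ℝ} (h : 2 / r = ENNReal.ofReal x) : r⁻¹ = ENNReal.ofReal (x / 2) := by
    rw [ENNReal.ofReal_div_of_pos two_pos, ← h, ENNReal.ofReal_ofNat, div_eq_mul_inv 2 r, mul_comm,
      ENNReal.mul_div_cancel_right (by norm_num) (by norm_num)]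
  have h2p : 2 / p ≤ 1 := ENNReal.div_le_of_le_mul (by rwa [one_mul])
  have hp0 : p ≠ 0 := fun h => by simp [h] at hp2
  have htop : 2 / p ≠ ∞ := ne_top_of_le_ne_top (by simp) h2p
  have hpos : 0 < (2 / p).toReal :=
    ENNReal.toReal_pos (ENNReal.div_ne_zero.2 ⟨by norm_num, hp.ne⟩) htop
  have hle : (2 / p).toReal ≤ 1 := ENNReal.toReal_le_of_le_ofReal zero_le_one (by simpa using h2p)
  simp only [one_div] at hpp' hqq'
  have hp1 : p⁻¹ = ENNReal.ofReal ((2 / p).toReal / 2) := half (ENNReal.ofReal_toReal htop).symm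
  have hq1 : q⁻¹ = ENNReal.ofReal ((1 - (2 / p).toReal) / 2) := by
    apply half
    rw [hq, ENNReal.ofReal_sub _ hpos.le, ENNReal.ofReal_one, ENNReal.ofReal_toReal htop]
  generalize (2 / p).toReal = x at *
  rw [hp1] at hpp'
  rw [hq1] at hqq'
  -- Here x = 2/p, so α = 1 - 2/p = 2/q; the endpoint α = 0 is p = 2, q = ∞.
  refine ⟨1 - x, by linarith, by linarith, inv (by linarith) ?_, inv (by linarith) ?_,
    inv (by linarith) (dual (by linarith) hqq'), ?_⟩
  · rw [hp1]; congr 1; ring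
  · rw [dual hpos.le hpp']; congr 1; ring
  · rcases hle.eq_or_lt with h | h
    · refine Or.inl ⟨by linarith, ?_⟩
      rw [h] at hq1
      simpa using hq1
    · exact Or.inr ⟨by linarith, inv (by linarith) hq1⟩

lemma spaceNorm_two_U (t : ℝ) (f : L2) : spaceNorm 2 (U t f) = ‖f‖ₑ := by
  rw [spaceNorm_two (Lp.aestronglyMeasurable _), ← Lp.enorm_def, ← ofReal_norm, norm_U, ofReal_norm]

lemma mixedNorm_top_two_U_le (f : L2) : mixedNorm ∞ 2 (fun t => U t f) ≤ ‖f‖ₑ := by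
  simp only [mixedNorm, spaceNorm_two_U]
  exact eLpNormEssSup_le_of_ae_enorm_bound (.of_forall fun t => le_rfl)

end ZakharovStrichartz

end

theorem proposition2p5 (p q p' q' : ℝ≥0∞) (hp2 : 2 ≤ p) (hp : p < ∞)
    (hq : 2 / q = 1 - 2 / p) (hpp' : 1 / p + 1 / p' = 1) (hqq' : 1 / q + 1 / q' = 1) :
    ∃ c : ℝ≥0,
      (∀ f : L2,
        AEMeasurable (fun t : ℝ => spaceNorm p (U t f)) ∧
        mixedNorm q p (fun t => U t f) ≤ c * ‖f‖ₑ) ∧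
      (∀ g : ℝ → R3 → ℂ, MemMixed q' p' g →
        ∃ G : ℝ → L2, (∀ t : ℝ, IsGroupIntegral (fun t' => t - t') g (G t)) ∧
          AEMeasurable (fun t : ℝ => spaceNorm p (G t)) ∧
          mixedNorm q p (fun t => G t) ≤ c * mixedNorm q' p' g) ∧
      (∀ g : ℝ → R3 → ℂ, MemMixed q' p' g →
        ∃ h : L2, IsGroupIntegral (fun t => t) g h ∧
          ‖h‖ₑ ≤ c * mixedNorm q' p' g) := by
  obtain ⟨α, hα0, hα1, rfl, rfl, rfl, hqα⟩ := exists_admissible hp2 hp hq hpp' hqq'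
  have hP0 : 0 < 2 / (1 - α) := div_pos two_pos (by linarith)
  -- The maximum with 1 covers the unitary endpoint α = 0 and gives C ≤ C², so that C² serves all
  -- three estimates; the second one uses C twice.
  obtain ⟨C, hC, hCα, hhom⟩ : ∃ C : ℝ≥0, 1 ≤ (C : ℝ≥0∞) ∧ strichartzConst α ≤ C ∧ ∀ f : L2,
      mixedNorm q (ENNReal.ofReal (2 / (1 - α))) (fun t => U t f) ≤ C * ‖f‖ₑ := by
    have h1 : (1 : ℝ≥0∞) ≤ (max 1 (strichartzConst α).toNNReal : ℝ≥0) := by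
      exact_mod_cast le_max_left _ _
    have h2 : strichartzConst α ≤ (max 1 (strichartzConst α).toNNReal : ℝ≥0) := by
      rw [← ENNReal.coe_toNNReal (strichartzConst_ne_top α)]
      exact_mod_cast le_max_right _ _
    refine ⟨_, h1, h2, fun f => ?_⟩
    rcases hqα with ⟨rfl, rfl⟩ | ⟨hα, rfl⟩
    · rw [sub_zero, div_one, ENNReal.ofReal_ofNat]
      exact (mixedNorm_top_two_U_le f).trans (le_mul_of_one_le_left' h1)
    · exact (mixedNorm_U_le hα hα1 f).trans (mul_le_mul_left h2 _)
  have hCC : (C : ℝ≥0∞) ≤ (C * C : ℝ≥0) := by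
    rw [ENNReal.coe_mul]
    exact le_mul_of_one_le_left' hC
  refine ⟨C * C, fun f => ⟨(measurable_spaceNorm_U hP0 f).aemeasurable,
    (hhom f).trans (mul_le_mul_left hCC _)⟩, fun g hg => ?_, fun g hg => ?_⟩
  -- With h = ∫ U(-t')g(t') dt' the integral at time t is U(t)h, and the homogeneous estimate is
  -- applied to h.
  · obtain ⟨h, hh, hle⟩ := exists_isGroupIntegral continuous_neg
      (ENNReal.mul_ne_top (strichartzConst_ne_top α) hg.2.ne) hg.1 fun φ => by
        simpa only [neg_neg] using (lintegral_US_mul_le' hα0 hα1 φ hg.1).1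
    refine ⟨fun t => U t h, hh.translate, (measurable_spaceNorm_U hP0 h).aemeasurable,
      (hhom h).trans ?_⟩
    rw [ENNReal.coe_mul, mul_assoc]
    exact mul_le_mul_right (hle.trans (mul_le_mul_left hCα _)) _
  · obtain ⟨h, hh, hle⟩ := exists_isGroupIntegral continuous_id
      (ENNReal.mul_ne_top (strichartzConst_ne_top α) hg.2.ne) hg.1
      fun φ => (lintegral_US_mul_le' hα0 hα1 φ hg.1).2
    exact ⟨h, hh, hle.trans (mul_le_mul_left (hCα.trans hCC) _)⟩
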